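/- Let $N\ge 0$ and let $p_1,\dots,p_{2N}$, $c_1,\dots,c_{2N}$, $\xi_{10},\dots,\xi_{2N,0}$ be complex numbers with $p_i+p_j\neq 0$ for all $i,j$ (in particular $p_i\ne0$), with $$p_i^2-p_ip_{2N+1-i}+p_{2N+1-i}^2=0,\qquad c_i=-c_{2N+1-i}\qquad(1\le i\le 2N),$$ and put $c_{i,j}=\delta_{j,2N+1-i}\,c_i$. For $(x_1,x_{-1})\in\mathbb C^2$ let $\xi_i=p_ix_1+\frac1{p_i}x_{-1}+\xi_{i0}$ and let $\tau=\mathrm{pf}(1,2,\dots,2N)$ be the pfaffian with entries $$\mathrm{pf}(i,j)=c_{i,j}+\frac{p_i-p_j}{p_i+p_j}\,e^{\xi_i+\xi_j}.$$ Here $\mathrm{pf}(1,\dots,2N)=\sum \mathrm{sgn}(\pi)\,\mathrm{pf}(i_1,j_1)\cdots\mathrm{pf}(i_N,j_N)$, summed over the permutations $\pi=(i_1\,j_1\cdots i_N\,j_N)$ with $i_1<\dots<i_N$ and $i_k<j_k$. Where $\tau\ne0$, set $$f=\tau^2,\qquad u=-(\ln f)_{x_1x_1},\qquad x=x_{-1}-(\ln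 f)_{x_1},\qquad t=x_1,$$ where $(\ln f)_{x_1}=f_{x_1}/f$. Call a point $(x_1,x_{-1})$ regular if $\tau\ne0$ and $\partial x/\partial x_{-1}\neq0$ there. Then: 1. $u=-2(\ln\tau)_{x_1x_1}$ wherever $\tau\ne0$. 2. ($N$-soliton solution.) The set of regular points is open in $\mathbb C^2$ and the hodograph transformation $(x_1,x_{-1})\mapsto(x,t)$ is locally injective on it. On every open set $W$ of regular points on which it is injective, its image is open, and $u$, regarded as a function of $(x,t)$ on that image, is smooth (in the complex sense) and satisfies the reduced Ostrovsky equation $$\partial_x(\partial_t+u\,\partial_x)u-3u=0 .$$ 3. (Real solutions.) Let $D\subseteq\mathbb R^2$ be an open set of regular points $(x_1,x_{-1})$ at which $x$ is real. Then $u$ is real on $D$, and the statement in 2 holds over $\mathbb R$ with $D$ in place of the set of regular points: the hodograph transformation is locally injective on $D$, and on every open $W\subseteq D$ on which it is injective its image in $\mathbb R^2$ is open and $u$ is there a real smooth solution, as a function of $(x,t)$, of the reduced Ostrovsky equation. 4. Suppose in addition that $\operatorname{Re}(p_i+p_{2N+1-i})>0$ and $c_i\ne0$ for all $i$. If $x_1,x_{-1}\in\mathbb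 R$ and $\tau(s,x_{-1})\neq0$ for all real $s\le x_1$, then $u(\cdot,x_{-1})$ is integrable on $(-\infty,x_1]$ and $$x=x_{-1}+\int_{-\infty}^{x_1}u(x_1',x_{-1})\,dx_1'.$$ -/

import Mathlib

open scoped ContDiff

/-- The pfaffian of a `2N × 2N` array of pairings `pf(i,j) = A i j`: the sum of
`sgn(π) a_{i₁,j₁} ⋯ a_{i_N,j_N}` over all permutations `π = (i₁ j₁ i₂ j₂ … i_N j_N)` of the `2N` indices
with `i₁ < i₂ < ⋯ < i_N` and `i_k < j_k` for every `k`. -/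
def pfaffian {R : Type*} [CommRing R] {N : ℕ} (A : Matrix (Fin (2 * N)) (Fin (2 * N)) R) : R :=
  ∑ π : Equiv.Perm (Fin (2 * N)) with
      (∀ k l : Fin N, k < l →
        π ⟨2 * (k : ℕ), by have := k.isLt; omega⟩ < π ⟨2 * (l : ℕ), by have := l.isLt; omega⟩) ∧
      (∀ k : Fin N,
        π ⟨2 * (k : ℕ), by have := k.isLt; omega⟩ < π ⟨2 * (k : ℕ) + 1, by have := k.isLt; omega⟩),
    ((Equiv.Perm.sign π : ℤ) : R) *
      ∏ k : Fin N, A (π ⟨2 * (k : ℕ), by have := k.isLt; omega⟩)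
        (π ⟨2 * (k : ℕ) + 1, by have := k.isLt; omega⟩)

section Calculus

variable {𝕜 : Type*} [NontriviallyNormedField 𝕜]

/-- Partial derivative with respect to the first coordinate. -/
noncomputable def partialFst (F : 𝕜 × 𝕜 → 𝕜) (a : 𝕜 × 𝕜) : 𝕜 :=
  deriv (fun s => F (s, a.2)) a.1

/-- Partial derivative with respect to the second coordinate. -/
noncomputable def partialSnd (F : 𝕜 × 𝕜 → 𝕜) (a : 𝕜 × 𝕜) : 𝕜 :=
  deriv (fun s => F (a.1, s)) a.2

/-- The first partial derivative of `ln F`, i.e. `(∂₁ F) / F`. At a point where `F ≠ 0` this is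
the derivative of every local branch of the logarithm of `F`. -/
noncomputable def partialFstLog (F : 𝕜 × 𝕜 → 𝕜) (a : 𝕜 × 𝕜) : 𝕜 :=
  partialFst F a / F a

/-- `v = v(x,t)` is a smooth solution on the open set `V` of the reduced Ostrovsky equation
`∂ₓ(∂ₜ + v ∂ₓ)v - 3 v = 0`. Points of `𝕜 × 𝕜` are `(x, t)`. -/
def SolvesReducedOstrovskyOn (v : 𝕜 × 𝕜 → 𝕜) (V : Set (𝕜 × 𝕜)) : Prop :=
  IsOpen V ∧ ContDiffOn 𝕜 ∞ v V ∧
    ∀ q ∈ V, partialFst (fun r => partialSnd v r + v r * partialFst v r) q - 3 * v q = 0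

/-- The functions `X`, `u` of the parameters `a = (x₁, x₋₁) ∈ D` define, through the change of
variables `x = X(x₁, x₋₁)`, `t = x₁`, a solution of the reduced Ostrovsky equation: the change of
variables is locally injective on the open set `D`, and on each open `W ⊆ D` on which
it is injective, the function `v` of `(x,t)` given by `v(X(x₁,x₋₁), x₁) = u(x₁,x₋₁)` is a smooth
solution on the (open) image of `W`. -/
def IsParametricSolutionOn (X u : 𝕜 × 𝕜 → 𝕜) (D : Set (𝕜 × 𝕜)) : Prop :=
  IsOpen D ∧
  (∀ a ∈ D, ∃ W ⊆ D, IsOpen W ∧ a ∈ W ∧ Set.InjOn (fun b => (X b, b.1)) W) ∧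
  ∀ W ⊆ D, IsOpen W → Set.InjOn (fun b => (X b, b.1)) W →
    ∃ v : 𝕜 × 𝕜 → 𝕜, (∀ b ∈ W, v (X b, b.1) = u b) ∧
      SolvesReducedOstrovskyOn v ((fun b => (X b, b.1)) '' W)

end Calculus

section Soliton

variable {N : ℕ}

/-- The phase `ξ_i = p_i x₁ + x₋₁ / p_i + ξ_{i0}`, with `a = (x₁, x₋₁)`. -/
noncomputable def phase (p ξ₀ : Fin (2 * N) → ℂ) (i : Fin (2 * N)) (a : ℂ × ℂ) : ℂ :=
  p i * a.1 + a.2 / p i + ξ₀ i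

/-- The pfaffian tau function with `pf(i,j) = c_{i,j} + (p_i - p_j)/(p_i + p_j) e^{ξ_i + ξ_j}` and
`c_{i,j} = δ_{j,2N+1-i} c_i`; `Fin.rev` is `i ↦ 2N+1-i` for indices counted from one. -/
noncomputable def solitonTau (p c ξ₀ : Fin (2 * N) → ℂ) (a : ℂ × ℂ) : ℂ :=
  pfaffian (Matrix.of fun i j =>
    (if j = i.rev then c i else 0) +
      (p i - p j) / (p i + p j) * Complex.exp (phase p ξ₀ i a + phase p ξ₀ j a))

/-- `f = τ²`. -/
noncomputable def solitonF (p c ξ₀ : Fin (2 * N) → ℂ) (a : ℂ × ℂ) : ℂ :=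
  solitonTau p c ξ₀ a ^ 2

/-- `u = -(ln f)_{x₁x₁}`. -/
noncomputable def solitonU (p c ξ₀ : Fin (2 * N) → ℂ) (a : ℂ × ℂ) : ℂ :=
  -partialFst (partialFstLog (solitonF p c ξ₀)) a

/-- `x = x₋₁ - (ln f)_{x₁}`. -/
noncomputable def solitonX (p c ξ₀ : Fin (2 * N) → ℂ) (a : ℂ × ℂ) : ℂ :=
  a.2 - partialFstLog (solitonF p c ξ₀) a

/-- The points at which `τ ≠ 0` and the hodograph transformation `(x₁,x₋₁) ↦ (x,t)` has
non-vanishing Jacobian, i.e. `∂x/∂x₋₁ ≠ 0`. -/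
def solitonRegularSet (p c ξ₀ : Fin (2 * N) → ℂ) : Set (ℂ × ℂ) :=
  {a | solitonTau p c ξ₀ a ≠ 0 ∧ partialSnd (solitonX p c ξ₀) a ≠ 0}

/-- The inclusion `ℝ² ⊆ ℂ²`. -/
def complexPoint (a : ℝ × ℝ) : ℂ × ℂ := ((a.1 : ℂ), (a.2 : ℂ))

end Soliton

/-! Let `A` be the skew matrix under the pfaffian, `v_k` the vector with entries `p_i ^ k e^{ξ_i}`,
and `⟨k,l⟩ = v_kᵀ A⁻¹ v_l` (`solitonBracket`), which makes sense where `τ ≠ 0`. The denominators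
`p_i + p_j` cancel on differentiation, so `∂A/∂x₁` and `∂A/∂x₋₁` are the rank-two matrices `v₁v₀ᵀ -
v₀v₁ᵀ` and `v₀v₋₁ᵀ - v₋₁v₀ᵀ`. Hence derivatives of brackets are quadratic polynomials in brackets,
and `(ln τ)_{x₁} = tr(A⁻¹A_{x₁})/2 = ⟨0,1⟩`. This gives `x = x₋₁ - 2⟨0,1⟩` and `x_{x₁} = u =
-2(⟨0,2⟩ - ⟨0,1⟩²)`.

The condition on `p` enters only through `p_i³ + p_{2N+1-i}³ = 0`. Taking a trace against
`diag(p_i³)` turns it into `⟨0,3⟩ = 2⟨1,2⟩` (`solitonBracket_zero_three`). With it `u_{x₁}` involves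
only the indices 0, 1, 2, and one more derivative gives `u_{x₁x₋₁} = 3 x_{x₋₁} u`
(`hasDerivAt_partialFst_solitonU_snd`). Under the hodograph map `∂_{x₁} = ∂_t + u∂_x` and `∂_{x₋₁} =
x_{x₋₁}∂_x`, so division by the Jacobian `x_{x₋₁}` is the reduced Ostrovsky equation
(`isParametricSolutionOn_of_partial`).

The pfaffian facts rest on `pf(BABᵀ) = det B · pf A` (`pfaffian_conj`). The integral formula is the
fundamental theorem of calculus for `x_{x₁} = u`, with exponential decay of the brackets as `x₁ →
-∞` (`isBigO_solitonBracket`). -/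

/-! ### Pfaffians: behaviour under congruence, and invertibility. -/

section Pfaffian

/-- The index `2k` or `2k+1` of the `k`-th pair. -/
def pairIndex {N : ℕ} (x : Fin N × Bool) : Fin (2 * N) :=
  ⟨2 * (x.1 : ℕ) + x.2.toNat, by have := x.1.isLt; have := Bool.toNat_lt x.2; omega⟩

/-- The `2N` indices as `N` consecutive pairs. -/
noncomputable def pairEquiv (N : ℕ) : Fin N × Bool ≃ Fin (2 * N) :=
  Equiv.ofBijective pairIndex <| by
    constructor
    · rintro ⟨k, a⟩ ⟨l, b⟩ h
      have h' : 2 * (k : ℕ) + a.toNat = 2 * (l : ℕ) + b.toNat := congrArg Fin.val h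
      have ha := Bool.toNat_lt a
      have hb := Bool.toNat_lt b
      have hk : k = l := Fin.ext (by omega)
      subst hk
      have hab : a.toNat = b.toNat := by omega
      cases a <;> cases b <;> simp_all
    · intro i
      refine ⟨(⟨i / 2, by omega⟩, decide (i.val % 2 = 1)), Fin.ext ?_⟩
      rcases Nat.mod_two_eq_zero_or_one i with h | h <;> simp [pairIndex, h] <;> omega

variable {R : Type*} [CommRing R] {N : ℕ}

/-- The signed summand of the pfaffian that belongs to the permutation `π`. -/
noncomputable def pfaffianTerm (A : Matrix (Fin (2 * N)) (Fin (2 * N)) R)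
    (π : Equiv.Perm (Fin (2 * N))) : R :=
  ((Equiv.Perm.sign π : ℤ) : R) *
    ∏ k : Fin N, A (π (pairEquiv N (k, false))) (π (pairEquiv N (k, true)))

/-- The permutations over which the pfaffian is summed. -/
def IsPfaffianOrdered (π : Equiv.Perm (Fin (2 * N))) : Prop :=
  StrictMono (fun k : Fin N => π (pairEquiv N (k, false))) ∧
    ∀ k : Fin N, π (pairEquiv N (k, false)) < π (pairEquiv N (k, true))

open scoped Classical in
theorem pfaffian_eq_sum_pfaffianTerm (A : Matrix (Fin (2 * N)) (Fin (2 * N)) R) :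
    pfaffian A = ∑ π : {π : Equiv.Perm (Fin (2 * N)) // IsPfaffianOrdered π},
      pfaffianTerm A π := by
  rw [pfaffian]
  exact Finset.sum_subtype _ (p := IsPfaffianOrdered)
    (fun π => by simp only [Finset.mem_filter, Finset.mem_univ, true_and]; rfl) (pfaffianTerm A)

/-- The permutation of the indices that permutes the pairs by `σ` and the entries of the pair
`σ k` by `ε k`. -/
noncomputable def pairPerm (h : Equiv.Perm (Fin N) × (Fin N → Equiv.Perm Bool)) :
    Equiv.Perm (Fin (2 * N)) :=
  (pairEquiv N).permCongr (Equiv.prodShear h.1 h.2)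

theorem pairPerm_apply (h : Equiv.Perm (Fin N) × (Fin N → Equiv.Perm Bool)) (k : Fin N)
    (b : Bool) : pairPerm h (pairEquiv N (k, b)) = pairEquiv N (h.1 k, h.2 k b) := by
  simp [pairPerm, Equiv.permCongr_apply, Equiv.prodShear]

/-- Permuting the pairs by `σ` acts once on the first entries and once on the second ones, so it
contributes `sign σ ^ 2 = 1`; only the flips inside pairs count. -/
theorem sign_pairPerm (h : Equiv.Perm (Fin N) × (Fin N → Equiv.Perm Bool)) :
    Equiv.Perm.sign (pairPerm h) = ∏ k, Equiv.Perm.sign (h.2 k) := by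
  have hs : (Equiv.prodShear h.1 h.2 : Equiv.Perm (Fin N × Bool)) =
      Equiv.prodCongrLeft (fun _ : Bool => h.1) * Equiv.prodCongrRight h.2 := by
    ext x <;> simp [Equiv.prodShear]
  rw [pairPerm, Equiv.Perm.sign_permCongr, hs, Equiv.Perm.sign_mul,
    Equiv.Perm.sign_prodCongrLeft, Equiv.Perm.sign_prodCongrRight]
  simp

/-- A flip inside a pair changes both the sign of the permutation and, by skew-symmetry, the sign of
an entry; moving whole pairs only reorders the product. -/
theorem pfaffianTerm_mul_pairPerm {A : Matrix (Fin (2 * N)) (Fin (2 * N)) R}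
    (hA : ∀ i j, A i j = -A j i) (π : Equiv.Perm (Fin (2 * N)))
    (h : Equiv.Perm (Fin N) × (Fin N → Equiv.Perm Bool)) :
    pfaffianTerm A (π * pairPerm h) = pfaffianTerm A π := by
  have hflip : ∀ (e : Equiv.Perm Bool) (k : Fin N),
      A (π (pairEquiv N (k, e false))) (π (pairEquiv N (k, e true))) =
        ((Equiv.Perm.sign e : ℤ) : R) *
          A (π (pairEquiv N (k, false))) (π (pairEquiv N (k, true))) := by
    intro e k
    have he : e = 1 ∨ e = Equiv.swap false true := by revert e; decide
    rcases he with rfl | rfl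
    · simp
    · rw [Equiv.swap_apply_left, Equiv.swap_apply_right, Equiv.Perm.sign_swap (by decide), hA]
      simp
  simp only [pfaffianTerm, Equiv.Perm.coe_mul, Function.comp_apply, pairPerm_apply, hflip,
    Finset.prod_mul_distrib, Equiv.Perm.sign_mul, sign_pairPerm]
  rw [Equiv.prod_comp h.1 fun k => A (π (pairEquiv N (k, false))) (π (pairEquiv N (k, true))),
    ← mul_assoc]
  congr 1
  push_cast
  rw [mul_assoc, ← Finset.prod_mul_distrib]
  have : ∀ k, ((Equiv.Perm.sign (h.2 k) : ℤ) : R) * ((Equiv.Perm.sign (h.2 k) : ℤ) : R) = 1 := by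
    intro k
    rcases Int.units_eq_one_or (Equiv.Perm.sign (h.2 k)) with h' | h' <;> simp [h']
  simp [this]

/-- The ordered permutations are a transversal for the left cosets of the group of pair
permutations. The sum over all permutations is therefore a multiple of the pfaffian, and it is
easier to expand. -/
theorem bijective_mul_pairPerm :
    Function.Bijective
      (fun x : {π : Equiv.Perm (Fin (2 * N)) // IsPfaffianOrdered π} ×
          (Equiv.Perm (Fin N) × (Fin N → Equiv.Perm Bool)) => x.1.1 * pairPerm x.2) := by
  constructor
  · rintro ⟨⟨c, hc⟩, h⟩ ⟨⟨c', hc'⟩, h'⟩ heq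
    have key : ∀ k b, c (pairEquiv N (h.1 k, h.2 k b)) = c' (pairEquiv N (h'.1 k, h'.2 k b)) := by
      intro k b
      have := DFunLike.congr_fun heq (pairEquiv N (k, b))
      simpa [pairPerm_apply] using this
    -- The minimum and maximum over a pair do not see the flips, so they recover the ordered
    -- representative.
    have hmin : ∀ (c : Equiv.Perm (Fin (2 * N))), IsPfaffianOrdered c → ∀ (e : Equiv.Perm Bool) k,
        min (c (pairEquiv N (k, e false))) (c (pairEquiv N (k, e true))) =
          c (pairEquiv N (k, false)) ∧
        max (c (pairEquiv N (k, e false))) (c (pairEquiv N (k, e true))) =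
          c (pairEquiv N (k, true)) := by
      intro c hc e k
      have he : e = 1 ∨ e = Equiv.swap false true := by revert e; decide
      have := (hc.2 k).le
      rcases he with rfl | rfl <;> simp [this]
    have h0 : ∀ k, c (pairEquiv N (h.1 k, false)) = c' (pairEquiv N (h'.1 k, false)) := by
      intro k
      rw [← (hmin c hc (h.2 k) _).1, ← (hmin c' hc' (h'.2 k) _).1, key, key]
    have h1 : ∀ k, c (pairEquiv N (h.1 k, true)) = c' (pairEquiv N (h'.1 k, true)) := by
      intro k
      rw [← (hmin c hc (h.2 k) _).2, ← (hmin c' hc' (h'.2 k) _).2, key, key]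
    have hrange : (fun k : Fin N => c (pairEquiv N (k, false))) =
        fun k : Fin N => c' (pairEquiv N (k, false)) := by
      refine (StrictMono.range_inj hc.1 hc'.1).1 (Set.ext fun z => ⟨?_, ?_⟩)
      · rintro ⟨k, rfl⟩
        exact ⟨h'.1 (h.1.symm k), by simpa using (h0 (h.1.symm k)).symm⟩
      · rintro ⟨k, rfl⟩
        exact ⟨h.1 (h'.1.symm k), by simpa using h0 (h'.1.symm k)⟩
    have hσ : h.1 = h'.1 := by
      ext1 k
      have := (h0 k).trans (congrFun hrange (h'.1 k)).symm
      simpa using this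
    have hcc : c = c' := by
      ext1 i
      obtain ⟨⟨k, b⟩, rfl⟩ := (pairEquiv N).surjective i
      obtain ⟨k, rfl⟩ := h.1.surjective k
      cases b
      · rw [h0, hσ]
      · rw [h1, hσ]
    subst hcc
    have hε : h.2 = h'.2 := by
      ext k b
      have := key k b
      rw [hσ] at this
      simpa using this
    simp [Prod.ext_iff, hσ, hε]
  · intro π
    set m : Fin N → Fin (2 * N) := fun k =>
      min (π (pairEquiv N (k, false))) (π (pairEquiv N (k, true))) with hm
    have hmem : ∀ k, ∃ b, m k = π (pairEquiv N (k, b)) := by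
      intro k
      rcases min_choice (π (pairEquiv N (k, false))) (π (pairEquiv N (k, true))) with h | h
      exacts [⟨_, h⟩, ⟨_, h⟩]
    have hinj : Function.Injective m := by
      intro k l hkl
      obtain ⟨b, hb⟩ := hmem k
      obtain ⟨b', hb'⟩ := hmem l
      rw [hb, hb'] at hkl
      simpa using congrArg Prod.fst ((pairEquiv N).injective (π.injective hkl))
    -- Existence: sort the pairs by their smaller entry, then flip the pairs that are in the wrong
    -- order.
    set ρ := Tuple.sort m with hρ
    have hmono : StrictMono (m ∘ ρ) :=
      (Tuple.monotone_sort m).strictMono_of_injective (hinj.comp ρ.injective)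
    set ε : Fin N → Equiv.Perm Bool := fun k =>
      if π (pairEquiv N (ρ k, false)) < π (pairEquiv N (ρ k, true)) then 1
      else Equiv.swap false true with hε
    have hval : ∀ k, π (pairEquiv N (ρ k, ε k false)) = m (ρ k) ∧
        π (pairEquiv N (ρ k, ε k false)) < π (pairEquiv N (ρ k, ε k true)) := by
      intro k
      by_cases hk : π (pairEquiv N (ρ k, false)) < π (pairEquiv N (ρ k, true))
      · simp [hε, hm, hk, hk.le]
      · have hne : π (pairEquiv N (ρ k, true)) ≠ π (pairEquiv N (ρ k, false)) := by simp
        have hlt := lt_of_le_of_ne (not_lt.1 hk) hne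
        simp [hε, hm, hk, hlt, hlt.le]
    refine ⟨⟨⟨π * pairPerm (ρ, ε), ?_, ?_⟩, (ρ.symm, fun k => (ε (ρ.symm k)).symm)⟩, ?_⟩
    · intro k l hkl
      simpa [pairPerm_apply, (hval _).1] using hmono hkl
    · intro k
      simpa [pairPerm_apply] using (hval k).2
    · ext1 i
      obtain ⟨⟨k, b⟩, rfl⟩ := (pairEquiv N).surjective i
      simp [pairPerm_apply]

theorem sum_pfaffianTerm {A : Matrix (Fin (2 * N)) (Fin (2 * N)) R}
    (hA : ∀ i j, A i j = -A j i) :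
    ∑ π, pfaffianTerm A π =
      (Fintype.card (Equiv.Perm (Fin N) × (Fin N → Equiv.Perm Bool)) : R) * pfaffian A := by
  classical
  rw [pfaffian_eq_sum_pfaffianTerm, ← bijective_mul_pairPerm.sum_comp, Fintype.sum_prod_type]
  simp only [pfaffianTerm_mul_pairPerm hA, Finset.sum_const, Finset.card_univ, nsmul_eq_mul,
    Finset.mul_sum]

/-- Expand every entry of `BABᵀ` bilinearly, with `ψ` recording the chosen inner indices. For fixed
`ψ` the signed sum over `π` is a Leibniz determinant of columns of `B`. -/
theorem sum_pfaffianTerm_conj_eq_sum_det (A B : Matrix (Fin (2 * N)) (Fin (2 * N)) R) :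
    ∑ π, pfaffianTerm (B * A * B.transpose) π =
      ∑ ψ : Fin N → Bool → Fin (2 * N), (∏ k, A (ψ k false) (ψ k true)) *
        (B.submatrix id fun i => ψ ((pairEquiv N).symm i).1 ((pairEquiv N).symm i).2).det := by
  have hentry : ∀ x : Bool → Fin (2 * N), (B * A * B.transpose) (x false) (x true) =
      ∑ g : Bool → Fin (2 * N), A (g false) (g true) * ∏ b, B (x b) (g b) := by
    intro x
    rw [← (Equiv.boolArrowEquivProd (Fin (2 * N))).symm.sum_comp, Fintype.sum_prod_type,
      Finset.sum_comm]
    simp only [Matrix.mul_apply, Matrix.transpose_apply, Finset.sum_mul]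
    refine Finset.sum_congr rfl fun j _ => Finset.sum_congr rfl fun i _ => ?_
    simp [Equiv.boolArrowEquivProd]
    ring
  simp only [pfaffianTerm, Matrix.det_apply', Matrix.submatrix_apply, id, Finset.mul_sum]
  rw [Finset.sum_comm]
  refine Finset.sum_congr rfl fun π _ => ?_
  have := fun k => hentry fun b => π (pairEquiv N (k, b))
  simp only [this, Finset.prod_univ_sum, Fintype.piFinset_univ, Finset.mul_sum]
  refine Finset.sum_congr rfl fun ψ _ => ?_
  rw [← (pairEquiv N).prod_comp, Fintype.prod_prod_type, Finset.prod_mul_distrib]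
  simp only [Equiv.symm_apply_apply]
  ring

theorem sum_pfaffianTerm_conj (A B : Matrix (Fin (2 * N)) (Fin (2 * N)) R) :
    ∑ π, pfaffianTerm (B * A * B.transpose) π = B.det * ∑ π, pfaffianTerm A π := by
  -- The case `B = 1` expresses the sum for `A` through the same `ψ`, so the two expansions match
  -- term by term up to the factor `det B`.
  have h1 := sum_pfaffianTerm_conj_eq_sum_det A 1
  rw [Matrix.transpose_one, one_mul, mul_one] at h1
  rw [sum_pfaffianTerm_conj_eq_sum_det, h1, Finset.mul_sum]
  refine Finset.sum_congr rfl fun ψ _ => ?_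
  rw [mul_left_comm, ← Matrix.det_mul]
  congr 2
  ext i j
  simp [Matrix.mul_apply, Matrix.one_apply]

/-- Both full sums are the order of the pair group times a pfaffian; in a domain of characteristic
zero that order cancels. -/
theorem pfaffian_conj [IsDomain R] [CharZero R] {A : Matrix (Fin (2 * N)) (Fin (2 * N)) R}
    (hA : A.transpose = -A) (B : Matrix (Fin (2 * N)) (Fin (2 * N)) R) :
    pfaffian (B * A * B.transpose) = B.det * pfaffian A := by
  have hanti : ∀ {A : Matrix (Fin (2 * N)) (Fin (2 * N)) R}, A.transpose = -A →
      ∀ i j, A i j = -A j i := by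
    intro A hA i j
    rw [← Matrix.transpose_apply A, hA, Matrix.neg_apply]
  have hB : (B * A * B.transpose).transpose = -(B * A * B.transpose) := by
    simp [Matrix.transpose_mul, hA, Matrix.mul_assoc]
  have h := sum_pfaffianTerm_conj A B
  rw [sum_pfaffianTerm (hanti hA), sum_pfaffianTerm (hanti hB), mul_left_comm] at h
  exact mul_left_cancel₀ (Nat.cast_ne_zero.2 Fintype.card_ne_zero) h

theorem isUnit_det_of_pfaffian_ne_zero {K : Type*} [Field K] [CharZero K]
    {A : Matrix (Fin (2 * N)) (Fin (2 * N)) K} (hA : A.transpose = -A) (h : pfaffian A ≠ 0) :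
    IsUnit A.det := by
  rw [isUnit_iff_ne_zero]
  intro hdet
  obtain ⟨v, hv, hAv⟩ := Matrix.exists_mulVec_eq_zero_iff.2 hdet
  obtain ⟨i, hi⟩ := Function.ne_iff.1 hv
  have hvA : Matrix.vecMul v A = 0 := by
    rw [← Matrix.mulVec_transpose, hA, Matrix.neg_mulVec, hAv, neg_zero]
  -- Since `Av = 0` and `vᵀA = 0`, the matrix `B = 1 + e_i vᵀ` fixes `A` under congruence, while
  -- `det B = 1 + v_i ≠ 1`. This forces `pf A = 0`.
  have h2 := pfaffian_conj hA (1 + Matrix.vecMulVec (Pi.single i 1) v)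
  have hB : (1 + Matrix.vecMulVec (Pi.single i 1) v) * A *
      (1 + Matrix.vecMulVec (Pi.single i 1) v).transpose = A := by
    rw [add_mul, one_mul, Matrix.vecMulVec_mul, hvA, Matrix.vecMulVec_zero, add_zero,
      Matrix.transpose_add, Matrix.transpose_one, Matrix.transpose_vecMulVec, mul_add, mul_one,
      Matrix.mul_vecMulVec, hAv, Matrix.zero_vecMulVec, add_zero]
  rw [hB, Matrix.vecMulVec_eq Unit, Matrix.det_one_add_replicateCol_mul_replicateRow] at h2
  rw [dotProduct_single, mul_one, add_mul, one_mul, left_eq_add] at h2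
  exact (mul_ne_zero hi h) h2
end Pfaffian

/-! ### Derivatives of inverses and pfaffians of matrix curves. -/

section MatrixCalculus

open Matrix

variable {𝕜 : Type*} [NontriviallyNormedField 𝕜] {E : Type*} [NormedAddCommGroup E]
  [NormedSpace 𝕜 E] {n : ℕ∞ω} {m : Type*} [Fintype m] [DecidableEq m] {N : ℕ}

theorem ContDiffAt.matrix_det {A : E → Matrix m m 𝕜} {x : E}
    (hA : ∀ i j, ContDiffAt 𝕜 n (fun y => A y i j) x) :
    ContDiffAt 𝕜 n (fun y => (A y).det) x := by
  simp only [det_apply']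
  exact ContDiffAt.sum fun σ _ => contDiffAt_const.mul (contDiffAt_prod fun i _ => hA _ _)

theorem ContDiffAt.matrix_inv_apply {A : E → Matrix m m 𝕜} {x : E}
    (hA : ∀ i j, ContDiffAt 𝕜 n (fun y => A y i j) x) (hx : IsUnit (A x).det) (i j : m) :
    ContDiffAt 𝕜 n (fun y => (A y)⁻¹ i j) x := by
  simp only [inv_def, Matrix.smul_apply, adjugate_apply, Ring.inverse_eq_inv', smul_eq_mul]
  refine ((ContDiffAt.matrix_det hA).inv hx.ne_zero).mul (ContDiffAt.matrix_det fun k l => ?_)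
  by_cases hk : k = j
  · subst hk
    simpa only [updateRow_self] using contDiffAt_const
  · simpa only [updateRow_ne hk] using hA k l

theorem ContDiff.pfaffian {A : E → Matrix (Fin (2 * N)) (Fin (2 * N)) 𝕜}
    (hA : ∀ i j, ContDiff 𝕜 n (fun y => A y i j)) :
    ContDiff 𝕜 n (fun y => _root_.pfaffian (A y)) := by
  unfold _root_.pfaffian
  exact ContDiff.sum fun π _ => contDiff_const.mul (contDiff_prod fun k _ => hA _ _)

/-- The derivative of the inverse of a matrix along a curve. -/
theorem HasDerivAt.matrix_inv_apply {A : 𝕜 → Matrix m m 𝕜} {A' : Matrix m m 𝕜} {s : 𝕜}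
    (hA : ∀ i j, HasDerivAt (fun r => A r i j) (A' i j) s)
    (hsmooth : ∀ i j, ContDiffAt 𝕜 1 (fun r => A r i j) s) (hs : IsUnit (A s).det) (i j : m) :
    HasDerivAt (fun r => (A r)⁻¹ i j) ((-((A s)⁻¹ * A' * (A s)⁻¹)) i j) s := by
  have hdiff : ∀ i j, DifferentiableAt 𝕜 (fun r => (A r)⁻¹ i j) s := fun i j =>
    (ContDiffAt.matrix_inv_apply hsmooth hs i j).differentiableAt one_ne_zero
  set M' : Matrix m m 𝕜 := Matrix.of fun i j => _root_.deriv (fun r => (A r)⁻¹ i j) s with hM'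
  have hM : ∀ i j, HasDerivAt (fun r => (A r)⁻¹ i j) (M' i j) s := fun i j =>
    (hdiff i j).hasDerivAt
  have hunit : ∀ᶠ r in nhds s, IsUnit (A r).det := by
    have := (ContDiffAt.matrix_det hsmooth).continuousAt.eventually_ne hs.ne_zero
    filter_upwards [this] with r hr using isUnit_iff_ne_zero.2 hr
  -- Product rule for `A A⁻¹ = 1`, which holds near `s`.
  have hprod : A' * (A s)⁻¹ + A s * M' = 0 := by
    ext k l
    have h1 : HasDerivAt (fun r => ∑ q, A r k q * (A r)⁻¹ q l)
        (∑ q, (A' k q * (A s)⁻¹ q l + A s k q * M' q l)) s :=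
      HasDerivAt.fun_sum fun q _ => (hA k q).mul (hM q l)
    have h2 : (fun r => ∑ q, A r k q * (A r)⁻¹ q l) =ᶠ[nhds s]
        fun _ => (1 : Matrix m m 𝕜) k l := by
      filter_upwards [hunit] with r hr
      rw [← mul_apply, mul_nonsing_inv _ hr]
    have h3 := h1.unique ((hasDerivAt_const s _).congr_of_eventuallyEq h2)
    simpa [mul_apply, Finset.sum_add_distrib] using h3
  have : M' = -((A s)⁻¹ * A' * (A s)⁻¹) := by
    rw [← one_mul M', ← nonsing_inv_mul _ hs, Matrix.mul_assoc, eq_neg_of_add_eq_zero_right hprod,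
      Matrix.mul_neg, Matrix.mul_assoc]
  rw [← this]
  exact hM i j

/-- By the chain rule the derivative depends only on the value and velocity of the curve, so a curve
may be replaced by a more convenient one. -/
theorem HasDerivAt.pfaffian_unique {A B : 𝕜 → Matrix (Fin (2 * N)) (Fin (2 * N)) 𝕜}
    {A' : Matrix (Fin (2 * N)) (Fin (2 * N)) 𝕜} {s r : 𝕜} {d : 𝕜}
    (hA : ∀ i j, HasDerivAt (fun z => A z i j) (A' i j) s)
    (hB : ∀ i j, HasDerivAt (fun z => B z i j) (A' i j) r) (hAB : A s = B r)
    (hd : HasDerivAt (fun z => _root_.pfaffian (B z)) d r) :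
    HasDerivAt (fun z => _root_.pfaffian (A z)) d s := by
  have hF : ContDiff 𝕜 1 fun v : Fin (2 * N) → Fin (2 * N) → 𝕜 =>
      _root_.pfaffian (Matrix.of v) :=
    ContDiff.pfaffian fun i j => by simpa using contDiff_apply_apply 𝕜 𝕜 i j
  have key : ∀ (C : 𝕜 → Matrix (Fin (2 * N)) (Fin (2 * N)) 𝕜) (z : 𝕜),
      (∀ i j, HasDerivAt (fun z => C z i j) (A' i j) z) →
      HasDerivAt (fun z => _root_.pfaffian (C z))
        (fderiv 𝕜 (fun v : Fin (2 * N) → Fin (2 * N) → 𝕜 => _root_.pfaffian (Matrix.of v))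
          (fun i j => C z i j) (fun i j => A' i j)) z := by
    intro C z hC
    exact ((hF.differentiable one_ne_zero).differentiableAt.hasFDerivAt).comp_hasDerivAt
      (f := fun z => fun i j => C z i j) z
      (hasDerivAt_pi.2 fun i => hasDerivAt_pi.2 fun j => hC i j)
  rw [hd.unique (key B r hB), ← hAB]
  exact key A s hA

/-- The logarithmic derivative of the pfaffian of a curve of skew-symmetric matrices. -/
theorem HasDerivAt.pfaffian [CharZero 𝕜] {A : 𝕜 → Matrix (Fin (2 * N)) (Fin (2 * N)) 𝕜}
    {A' : Matrix (Fin (2 * N)) (Fin (2 * N)) 𝕜} {s : 𝕜}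
    (hA : ∀ i j, HasDerivAt (fun r => A r i j) (A' i j) s)
    (hskew : (A s)ᵀ = -A s) (hskew' : A'ᵀ = -A') (hs : IsUnit (A s).det) :
    HasDerivAt (fun r => _root_.pfaffian (A r))
      (((A s)⁻¹ * A').trace / 2 * _root_.pfaffian (A s)) s := by
  -- With this `K` one has `KA = AKᵀ = A'/2`, so the congruence curve `(1 + zK)A(1 + zK)ᵀ` has
  -- velocity `A'` at `z = 0`.
  set K : Matrix (Fin (2 * N)) (Fin (2 * N)) 𝕜 := (2⁻¹ : 𝕜) • (A' * (A s)⁻¹) with hK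
  have hinv : ((A s)⁻¹)ᵀ = -(A s)⁻¹ := by
    rw [transpose_nonsing_inv, hskew]
    exact inv_eq_right_inv (by rw [neg_mul_neg, mul_nonsing_inv _ hs])
  have hKA : K * A s = (2⁻¹ : 𝕜) • A' := by
    rw [hK, smul_mul, Matrix.mul_assoc, nonsing_inv_mul _ hs, Matrix.mul_one]
  have hAK : A s * Kᵀ = (2⁻¹ : 𝕜) • A' := by
    rw [hK, transpose_smul, transpose_mul, hinv, hskew', neg_mul_neg, Matrix.mul_smul,
      ← Matrix.mul_assoc, mul_nonsing_inv _ hs, Matrix.one_mul]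
  have hcurve : ∀ z : 𝕜, (1 + z • K) * A s * (1 + z • K)ᵀ =
      A s + z • A' + z ^ 2 • (K * A s * Kᵀ) := by
    intro z
    rw [transpose_add, transpose_one, transpose_smul, add_mul, Matrix.one_mul, mul_add, mul_one,
      add_mul, smul_mul, hKA, Matrix.mul_smul, hAK, smul_mul, Matrix.mul_smul]
    ext i j
    simp only [Matrix.add_apply, Matrix.smul_apply, smul_eq_mul]
    ring_nf
  refine HasDerivAt.pfaffian_unique (B := fun z => (1 + z • K) * A s * (1 + z • K)ᵀ) (r := 0) hA
    (fun i j => ?_) (by simp) ?_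
  · simp only [hcurve, Matrix.add_apply, Matrix.smul_apply, smul_eq_mul]
    have := (((hasDerivAt_id (0 : 𝕜)).mul_const (A' i j)).const_add (A s i j)).add
      (((hasDerivAt_id (0 : 𝕜)).pow 2).mul_const ((K * A s * Kᵀ) i j))
    refine HasDerivAt.congr_deriv this ?_
    simp
  -- Along the congruence curve the pfaffian is `det(1 + zK) pf A`, and `det(1 + zK) = 1 + z tr K +
  -- O(z²)`.
  · have hdet : (fun z : 𝕜 => _root_.pfaffian ((1 + z • K) * A s * (1 + z • K)ᵀ)) = fun z =>
        (1 + K.trace * z + Polynomial.eval z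
          (1 + (Polynomial.X : Polynomial 𝕜) • K.map Polynomial.C).det.divX.divX * z ^ 2) *
          _root_.pfaffian (A s) := by
      funext z
      rw [pfaffian_conj hskew, det_one_add_smul]
    rw [hdet]
    have := (((hasDerivAt_id (0 : 𝕜)).const_mul K.trace).const_add 1).add
      ((((1 + (Polynomial.X : Polynomial 𝕜) • K.map Polynomial.C).det.divX.divX).hasDerivAt
        (0 : 𝕜)).mul ((hasDerivAt_id (0 : 𝕜)).pow 2))
    have := this.mul_const (_root_.pfaffian (A s))
    refine HasDerivAt.congr_deriv this ?_
    simp [hK, trace_mul_comm A', div_eq_inv_mul]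

end MatrixCalculus

/-! ### The bilinear form of an inverse matrix and rank-one perturbations. -/

section SkewForm

open Matrix

variable {𝕜 : Type*} [NontriviallyNormedField 𝕜] {m : Type*} [Fintype m]

theorem HasDerivAt.dotProduct_inv_mulVec [DecidableEq m] {A : 𝕜 → Matrix m m 𝕜} {A' : Matrix m m 𝕜}
    {v w : 𝕜 → m → 𝕜} {v' w' : m → 𝕜} {s : 𝕜}
    (hA : ∀ i j, HasDerivAt (fun r => A r i j) (A' i j) s)
    (hsmooth : ∀ i j, ContDiffAt 𝕜 1 (fun r => A r i j) s) (hs : IsUnit (A s).det)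
    (hv : ∀ i, HasDerivAt (fun r => v r i) (v' i) s)
    (hw : ∀ i, HasDerivAt (fun r => w r i) (w' i) s) :
    HasDerivAt (fun r => v r ⬝ᵥ (A r)⁻¹ *ᵥ w r)
      (v' ⬝ᵥ (A s)⁻¹ *ᵥ w s + v s ⬝ᵥ (A s)⁻¹ *ᵥ w' -
        v s ⬝ᵥ ((A s)⁻¹ * A' * (A s)⁻¹) *ᵥ w s) s := by
  have h : HasDerivAt (fun r => ∑ i, v r i * ∑ j, (A r)⁻¹ i j * w r j)
      (∑ i, (v' i * (∑ j, (A s)⁻¹ i j * w s j) + v s i *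
        ∑ j, ((-((A s)⁻¹ * A' * (A s)⁻¹)) i j * w s j + (A s)⁻¹ i j * w' j))) s :=
    HasDerivAt.fun_sum fun i _ => (hv i).mul <| HasDerivAt.fun_sum fun j _ =>
      (HasDerivAt.matrix_inv_apply hA hsmooth hs i j).mul (hw j)
  refine HasDerivAt.congr_deriv h ?_
  simp only [dotProduct, mulVec, Finset.sum_add_distrib, mul_add, Matrix.neg_apply, neg_mul,
    Finset.sum_neg_distrib, mul_neg]
  ring

theorem dotProduct_mul_vecMulVec_mul_mulVec {R : Type*} [CommRing R] (M : Matrix m m R)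
    (v w x y : m → R) :
    v ⬝ᵥ (M * vecMulVec x y * M) *ᵥ w = (v ⬝ᵥ M *ᵥ x) * (y ⬝ᵥ M *ᵥ w) := by
  rw [mul_vecMulVec, vecMulVec_mul, vecMulVec_mulVec, ← dotProduct_mulVec]
  simp [mul_comm]

theorem trace_mul_vecMulVec {R : Type*} [CommRing R] (M : Matrix m m R) (x y : m → R) :
    (M * vecMulVec x y).trace = y ⬝ᵥ M *ᵥ x := by
  rw [mul_vecMulVec, trace_vecMulVec, dotProduct_comm]

/-- The form `v ↦ vᵀ A⁻¹ w` of a skew-symmetric matrix is alternating. -/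
theorem dotProduct_inv_mulVec_skew [DecidableEq m] {K : Type*} [Field K] {A : Matrix m m K}
    (hA : Aᵀ = -A) (v w : m → K) (hdet : IsUnit A.det) : v ⬝ᵥ A⁻¹ *ᵥ w = -(w ⬝ᵥ A⁻¹ *ᵥ v) := by
  have hinv : A⁻¹ᵀ = -A⁻¹ := by
    rw [transpose_nonsing_inv, hA]
    exact inv_eq_right_inv (by rw [neg_mul_neg, mul_nonsing_inv _ hdet])
  rw [dotProduct_comm, ← vecMul_transpose, hinv, ← dotProduct_mulVec, neg_mulVec, dotProduct_neg]

end SkewForm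

/-! ### Differentiation rules for the brackets and the cubic reduction. -/

section SolitonAlgebra

open Matrix

variable {N : ℕ} (p c ξ₀ : Fin (2 * N) → ℂ)

/-- The skew-symmetric matrix whose pfaffian is the tau function. -/
noncomputable def solitonMatrix (a : ℂ × ℂ) : Matrix (Fin (2 * N)) (Fin (2 * N)) ℂ :=
  Matrix.of fun i j => (if j = i.rev then c i else 0) +
    (p i - p j) / (p i + p j) * Complex.exp (phase p ξ₀ i a + phase p ξ₀ j a)

/-- The vector with the entries `p_i ^ k e^{ξ_i}`. -/
noncomputable def solitonVec (k : ℤ) (a : ℂ × ℂ) (i : Fin (2 * N)) : ℂ :=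
  p i ^ k * Complex.exp (phase p ξ₀ i a)

/-- The alternating form of `A⁻¹` on the vectors `p_i ^ k e^{ξ_i}` and `p_i ^ l e^{ξ_i}`. -/
noncomputable def solitonBracket (k l : ℤ) (a : ℂ × ℂ) : ℂ :=
  solitonVec p ξ₀ k a ⬝ᵥ (solitonMatrix p c ξ₀ a)⁻¹ *ᵥ solitonVec p ξ₀ l a

theorem contDiff_phase {n : ℕ∞ω} (i : Fin (2 * N)) : ContDiff ℂ n (phase p ξ₀ i) := by
  unfold phase
  fun_prop

theorem contDiff_solitonVec {n : ℕ∞ω} (k : ℤ) (i : Fin (2 * N)) :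
    ContDiff ℂ n fun a => solitonVec p ξ₀ k a i :=
  contDiff_const.mul (contDiff_phase p ξ₀ i).cexp

theorem contDiff_solitonMatrix {n : ℕ∞ω} (i j : Fin (2 * N)) :
    ContDiff ℂ n fun a => solitonMatrix p c ξ₀ a i j :=
  contDiff_const.add (contDiff_const.mul ((contDiff_phase p ξ₀ i).add (contDiff_phase p ξ₀ j)).cexp)

theorem contDiff_solitonTau {n : ℕ∞ω} : ContDiff ℂ n (solitonTau p c ξ₀) :=
  ContDiff.pfaffian (contDiff_solitonMatrix p c ξ₀)

theorem contDiffAt_solitonBracket {n : ℕ∞ω} {a : ℂ × ℂ}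
    (ha : IsUnit (solitonMatrix p c ξ₀ a).det) (k l : ℤ) :
    ContDiffAt ℂ n (solitonBracket p c ξ₀ k l) a := by
  unfold solitonBracket dotProduct mulVec dotProduct
  exact ContDiffAt.sum fun i _ => (contDiff_solitonVec p ξ₀ k i).contDiffAt.mul <|
    ContDiffAt.sum fun j _ => (ContDiffAt.matrix_inv_apply
      (fun i j => (contDiff_solitonMatrix p c ξ₀ i j).contDiffAt) ha i j).mul
        (contDiff_solitonVec p ξ₀ l j).contDiffAt

variable {p c ξ₀}

theorem hasDerivAt_phase_fst (i : Fin (2 * N)) (a : ℂ × ℂ) :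
    HasDerivAt (fun s => phase p ξ₀ i (s, a.2)) (p i) a.1 := by
  have := (((hasDerivAt_id a.1).const_mul (p i)).add_const (a.2 / p i)).add_const (ξ₀ i)
  rwa [mul_one] at this

theorem hasDerivAt_phase_snd (i : Fin (2 * N)) (a : ℂ × ℂ) :
    HasDerivAt (fun s => phase p ξ₀ i (a.1, s)) (p i)⁻¹ a.2 := by
  have := (((hasDerivAt_id a.2).div_const (p i)).const_add (p i * a.1)).add_const (ξ₀ i)
  rwa [one_div] at this

theorem hasDerivAt_solitonVec_fst (hp : ∀ i, p i ≠ 0) (k : ℤ) (i : Fin (2 * N)) (a : ℂ × ℂ) :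
    HasDerivAt (fun s => solitonVec p ξ₀ k (s, a.2) i) (solitonVec p ξ₀ (k + 1) a i) a.1 := by
  refine ((hasDerivAt_phase_fst (p := p) (ξ₀ := ξ₀) i a).cexp.const_mul (p i ^ k)).congr_deriv ?_
  rw [solitonVec, zpow_add_one₀ (hp i)]
  ring

theorem hasDerivAt_solitonVec_snd (hp : ∀ i, p i ≠ 0) (k : ℤ) (i : Fin (2 * N)) (a : ℂ × ℂ) :
    HasDerivAt (fun s => solitonVec p ξ₀ k (a.1, s) i) (solitonVec p ξ₀ (k - 1) a i) a.2 := by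
  refine ((hasDerivAt_phase_snd (p := p) (ξ₀ := ξ₀) i a).cexp.const_mul (p i ^ k)).congr_deriv ?_
  rw [solitonVec, zpow_sub_one₀ (hp i)]
  ring

/-- The exponent contributes the factor `p_i + p_j`, which cancels the denominator and leaves `p_i -
p_j`: a matrix of rank at most two. -/
theorem hasDerivAt_solitonMatrix_fst (hp : ∀ i j, p i + p j ≠ 0) (i j : Fin (2 * N))
    (a : ℂ × ℂ) :
    HasDerivAt (fun s => solitonMatrix p c ξ₀ (s, a.2) i j)
      ((vecMulVec (solitonVec p ξ₀ 1 a) (solitonVec p ξ₀ 0 a) -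
        vecMulVec (solitonVec p ξ₀ 0 a) (solitonVec p ξ₀ 1 a)) i j) a.1 := by
  refine ((((hasDerivAt_phase_fst (p := p) (ξ₀ := ξ₀) i a).add
    (hasDerivAt_phase_fst j a)).cexp.const_mul ((p i - p j) / (p i + p j))).const_add
      _).congr_deriv ?_
  have := hp i j
  simp only [Matrix.sub_apply, vecMulVec_apply, solitonVec, Pi.add_apply, Complex.exp_add, zpow_one,
    zpow_zero]
  field_simp

/-- Here the factor is `1/p_i + 1/p_j = (p_i + p_j)/(p_i p_j)`, which leaves `1/p_j - 1/p_i`. -/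
theorem hasDerivAt_solitonMatrix_snd (hp : ∀ i j, p i + p j ≠ 0) (i j : Fin (2 * N))
    (a : ℂ × ℂ) :
    HasDerivAt (fun s => solitonMatrix p c ξ₀ (a.1, s) i j)
      ((vecMulVec (solitonVec p ξ₀ 0 a) (solitonVec p ξ₀ (-1) a) -
        vecMulVec (solitonVec p ξ₀ (-1) a) (solitonVec p ξ₀ 0 a)) i j) a.2 := by
  refine ((((hasDerivAt_phase_snd (p := p) (ξ₀ := ξ₀) i a).add
    (hasDerivAt_phase_snd j a)).cexp.const_mul ((p i - p j) / (p i + p j))).const_add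
      _).congr_deriv ?_
  have h := hp i j
  have hi : p i ≠ 0 := fun h0 => hp i i (by simp [h0])
  have hj : p j ≠ 0 := fun h0 => hp j j (by simp [h0])
  simp only [Matrix.sub_apply, vecMulVec_apply, solitonVec, Pi.add_apply, Complex.exp_add,
    _root_.zpow_neg, zpow_one, zpow_zero]
  field_simp
  ring

theorem solitonMatrix_transpose (hc : ∀ i, c i = -c i.rev) (a : ℂ × ℂ) :
    (solitonMatrix p c ξ₀ a)ᵀ = -solitonMatrix p c ξ₀ a := by
  ext i j
  simp only [solitonMatrix, transpose_apply, of_apply, Matrix.neg_apply]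
  have h1 : (if i = j.rev then c j else 0) = -(if j = i.rev then c i else 0) := by
    by_cases h : j = i.rev
    · subst h
      simpa using hc i.rev
    · have h' : i ≠ j.rev := fun h' => h (by simp [h'])
      simp [h, h']
  rw [h1, add_comm (p j), add_comm (phase p ξ₀ j a), ← neg_sub (p i)]
  ring

theorem solitonBracket_skew (hc : ∀ i, c i = -c i.rev) {a : ℂ × ℂ}
    (ha : IsUnit (solitonMatrix p c ξ₀ a).det) (k l : ℤ) :
    solitonBracket p c ξ₀ k l a = -solitonBracket p c ξ₀ l k a :=
  dotProduct_inv_mulVec_skew (solitonMatrix_transpose hc a) _ _ ha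

theorem solitonBracket_self (hc : ∀ i, c i = -c i.rev) {a : ℂ × ℂ}
    (ha : IsUnit (solitonMatrix p c ξ₀ a).det) (k : ℤ) : solitonBracket p c ξ₀ k k a = 0 :=
  self_eq_neg.1 (solitonBracket_skew hc ha k k)

theorem isUnit_det_solitonMatrix (hc : ∀ i, c i = -c i.rev) {a : ℂ × ℂ}
    (ha : solitonTau p c ξ₀ a ≠ 0) : IsUnit (solitonMatrix p c ξ₀ a).det :=
  isUnit_det_of_pfaffian_ne_zero (solitonMatrix_transpose hc a) ha

/-- The vectors shift their index, and the rank-two term `A⁻¹A'A⁻¹` splits into products of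
brackets. -/
theorem hasDerivAt_solitonBracket_fst (hp : ∀ i j, p i + p j ≠ 0) {a : ℂ × ℂ}
    (ha : IsUnit (solitonMatrix p c ξ₀ a).det) (k l : ℤ) :
    HasDerivAt (fun s => solitonBracket p c ξ₀ k l (s, a.2))
      (solitonBracket p c ξ₀ (k + 1) l a + solitonBracket p c ξ₀ k (l + 1) a -
        (solitonBracket p c ξ₀ k 1 a * solitonBracket p c ξ₀ 0 l a -
          solitonBracket p c ξ₀ k 0 a * solitonBracket p c ξ₀ 1 l a)) a.1 := by
  have hp0 : ∀ i, p i ≠ 0 := fun i h0 => hp i i (by simp [h0])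
  refine (HasDerivAt.dotProduct_inv_mulVec (A := fun s => solitonMatrix p c ξ₀ (s, a.2))
    (fun i j => hasDerivAt_solitonMatrix_fst hp i j a)
    (fun i j => ((contDiff_solitonMatrix p c ξ₀ i j).comp
      (contDiff_prodMk_left a.2)).contDiffAt) ha
    (fun i => hasDerivAt_solitonVec_fst hp0 k i a)
    (fun i => hasDerivAt_solitonVec_fst hp0 l i a)).congr_deriv ?_
  rw [mul_sub, sub_mul, sub_mulVec, dotProduct_sub, dotProduct_mul_vecMulVec_mul_mulVec,
    dotProduct_mul_vecMulVec_mul_mulVec]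
  rfl

theorem hasDerivAt_solitonBracket_snd (hp : ∀ i j, p i + p j ≠ 0) {a : ℂ × ℂ}
    (ha : IsUnit (solitonMatrix p c ξ₀ a).det) (k l : ℤ) :
    HasDerivAt (fun s => solitonBracket p c ξ₀ k l (a.1, s))
      (solitonBracket p c ξ₀ (k - 1) l a + solitonBracket p c ξ₀ k (l - 1) a -
        (solitonBracket p c ξ₀ k 0 a * solitonBracket p c ξ₀ (-1) l a -
          solitonBracket p c ξ₀ k (-1) a * solitonBracket p c ξ₀ 0 l a)) a.2 := by
  have hp0 : ∀ i, p i ≠ 0 := fun i h0 => hp i i (by simp [h0])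
  refine (HasDerivAt.dotProduct_inv_mulVec (A := fun s => solitonMatrix p c ξ₀ (a.1, s))
    (fun i j => hasDerivAt_solitonMatrix_snd hp i j a)
    (fun i j => ((contDiff_solitonMatrix p c ξ₀ i j).comp
      (contDiff_prodMk_right a.1)).contDiffAt) ha
    (fun i => hasDerivAt_solitonVec_snd hp0 k i a)
    (fun i => hasDerivAt_solitonVec_snd hp0 l i a)).congr_deriv ?_
  rw [mul_sub, sub_mul, sub_mulVec, dotProduct_sub, dotProduct_mul_vecMulVec_mul_mulVec,
    dotProduct_mul_vecMulVec_mul_mulVec]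
  rfl

theorem hasDerivAt_solitonTau_fst (hp : ∀ i j, p i + p j ≠ 0) (hc : ∀ i, c i = -c i.rev)
    {a : ℂ × ℂ} (ha : solitonTau p c ξ₀ a ≠ 0) :
    HasDerivAt (fun s => solitonTau p c ξ₀ (s, a.2))
      (solitonBracket p c ξ₀ 0 1 a * solitonTau p c ξ₀ a) a.1 := by
  have hdet := isUnit_det_solitonMatrix hc ha
  refine (HasDerivAt.pfaffian (A := fun s => solitonMatrix p c ξ₀ (s, a.2))
    (fun i j => hasDerivAt_solitonMatrix_fst hp i j a) (solitonMatrix_transpose hc a)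
    (by simp [transpose_vecMulVec]) hdet).congr_deriv ?_
  have h := solitonBracket_skew hc hdet 1 0
  rw [mul_sub, trace_sub, trace_mul_vecMulVec, trace_mul_vecMulVec]
  change (solitonBracket p c ξ₀ 0 1 a - solitonBracket p c ξ₀ 1 0 a) / 2 *
    solitonTau p c ξ₀ a = _
  rw [h]
  ring

/-- The period-three reduction. -/
theorem solitonBracket_zero_three (hp : ∀ i j, p i + p j ≠ 0)
    (hred : ∀ i, p i ^ 2 - p i * p i.rev + p i.rev ^ 2 = 0) (hc : ∀ i, c i = -c i.rev) {a : ℂ × ℂ}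
    (ha : IsUnit (solitonMatrix p c ξ₀ a).det) :
    solitonBracket p c ξ₀ 0 3 a = 2 * solitonBracket p c ξ₀ 1 2 a := by
  set A := solitonMatrix p c ξ₀ a with hA
  set v := fun k : ℤ => solitonVec p ξ₀ k a with hv
  set Q : Matrix (Fin (2 * N)) (Fin (2 * N)) ℂ := diagonal fun i => p i ^ 3 with hQ
  have hcube : ∀ i, p i ^ 3 + p i.rev ^ 3 = 0 := fun i => by
    linear_combination (p i + p i.rev) * hred i
  -- The constants `c_{i,j}` drop out because `p_i³ + p_j³ = 0` on their support; elsewhere `p_i +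
  -- p_j` divides `p_i³ + p_j³`, leaving a polynomial in `p_i`, `p_j`.
  have hQA : Q * A + A * Q = vecMulVec (v 3) (v 0) - (2 : ℂ) • vecMulVec (v 2) (v 1) +
      (2 : ℂ) • vecMulVec (v 1) (v 2) - vecMulVec (v 0) (v 3) := by
    ext i j
    have hij := hp i j
    have hcij : (p i ^ 3 + p j ^ 3) * (if j = i.rev then c i else 0) = 0 := by
      split_ifs with h
      · rw [h, hcube, zero_mul]
      · rw [mul_zero]
    simp only [hQ, hA, hv, Matrix.add_apply, Matrix.sub_apply, Matrix.smul_apply, diagonal_mul,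
      mul_diagonal, vecMulVec_apply, solitonVec, solitonMatrix, of_apply, Complex.exp_add,
      smul_eq_mul, zpow_ofNat]
    have hK : (p i ^ 3 + p j ^ 3) * ((p i - p j) / (p i + p j)) =
        p i ^ 3 - 2 * p i ^ 2 * p j + 2 * p i * p j ^ 2 - p j ^ 3 := by
      field_simp
      ring
    linear_combination hcij + Complex.exp (phase p ξ₀ i a) * Complex.exp (phase p ξ₀ j a) * hK
  -- Reversing the indices negates each `p_i³`, so the sum equals its own negative.
  have htrQ : Q.trace = 0 := by
    rw [hQ, trace_diagonal]
    have h1 : ∑ i : Fin (2 * N), p i.rev ^ 3 = ∑ i, p i ^ 3 :=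
      Equiv.sum_comp Fin.revPerm fun i => p i ^ 3
    have h2 := Finset.sum_congr rfl fun i (_ : i ∈ Finset.univ) => hcube i
    rw [Finset.sum_add_distrib, h1, Finset.sum_const_zero] at h2
    linear_combination h2 / 2
  -- By cyclicity this trace is `2 tr Q`; evaluated through the rank-one terms of `hQA` it is a
  -- linear relation between brackets.
  have htr : (A⁻¹ * (Q * A + A * Q)).trace = 0 := by
    rw [mul_add, trace_add, ← Matrix.mul_assoc A⁻¹ A, nonsing_inv_mul _ ha, Matrix.one_mul,
      trace_mul_comm, Matrix.mul_assoc, mul_nonsing_inv _ ha, Matrix.mul_one, htrQ, add_zero]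
  rw [hQA, mul_sub, mul_add, mul_sub, Matrix.mul_smul, Matrix.mul_smul, trace_sub, trace_add,
    trace_sub, trace_smul, trace_smul, trace_mul_vecMulVec, trace_mul_vecMulVec,
    trace_mul_vecMulVec, trace_mul_vecMulVec] at htr
  change solitonBracket p c ξ₀ 0 3 a - (2 : ℂ) * solitonBracket p c ξ₀ 1 2 a +
    (2 : ℂ) * solitonBracket p c ξ₀ 2 1 a - solitonBracket p c ξ₀ 3 0 a = 0 at htr
  linear_combination htr / 2 - solitonBracket_skew hc ha 2 1 + solitonBracket_skew hc ha 3 0 / 2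

end SolitonAlgebra

/-! ### The functions `x` and `u` in terms of brackets, and the equation in `(x₁, x₋₁)`. -/

section SolitonEquation

variable {N : ℕ} {p c ξ₀ : Fin (2 * N) → ℂ}

theorem isOpen_solitonTau_ne_zero : IsOpen {a | solitonTau p c ξ₀ a ≠ 0} :=
  (contDiff_solitonTau p c ξ₀ (n := 0)).continuous.isOpen_preimage _ isOpen_ne

theorem eventually_solitonTau_ne_zero_fst {a : ℂ × ℂ} (ha : solitonTau p c ξ₀ a ≠ 0) :
    ∀ᶠ s in nhds a.1, solitonTau p c ξ₀ (s, a.2) ≠ 0 :=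
  (Continuous.prodMk_left a.2).continuousAt.eventually (isOpen_solitonTau_ne_zero.mem_nhds ha)

theorem eventually_solitonTau_ne_zero_snd {a : ℂ × ℂ} (ha : solitonTau p c ξ₀ a ≠ 0) :
    ∀ᶠ s in nhds a.2, solitonTau p c ξ₀ (a.1, s) ≠ 0 :=
  (Continuous.prodMk_right a.1).continuousAt.eventually (isOpen_solitonTau_ne_zero.mem_nhds ha)

theorem partialFstLog_solitonF {a : ℂ × ℂ} (ha : solitonTau p c ξ₀ a ≠ 0) :
    partialFstLog (solitonF p c ξ₀) a = 2 * partialFstLog (solitonTau p c ξ₀) a := by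
  have hd : DifferentiableAt ℂ (fun s => solitonTau p c ξ₀ (s, a.2)) a.1 :=
    (((contDiff_solitonTau p c ξ₀ (n := 1)).comp (contDiff_prodMk_left a.2)).differentiable
      one_ne_zero).differentiableAt
  have h : partialFst (solitonF p c ξ₀) a =
      2 * solitonTau p c ξ₀ a * partialFst (solitonTau p c ξ₀) a := by
    have := (hd.hasDerivAt.fun_pow 2).deriv
    simpa [partialFst, solitonF] using this
  rw [partialFstLog, partialFstLog, h, solitonF]
  field_simp

theorem solitonU_eq_partialFst {a : ℂ × ℂ} (ha : solitonTau p c ξ₀ a ≠ 0) :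
    solitonU p c ξ₀ a = -2 * partialFst (partialFstLog (solitonTau p c ξ₀)) a := by
  have h : (fun s => partialFstLog (solitonF p c ξ₀) (s, a.2)) =ᶠ[nhds a.1]
      fun s => 2 * partialFstLog (solitonTau p c ξ₀) (s, a.2) := by
    filter_upwards [eventually_solitonTau_ne_zero_fst ha] with s hs using partialFstLog_solitonF hs
  rw [solitonU, partialFst, h.deriv_eq, deriv_const_mul_field, partialFst]
  ring

section

variable (hp : ∀ i j, p i + p j ≠ 0) (hc : ∀ i, c i = -c i.rev)
include hp hc

theorem partialFstLog_solitonTau {a : ℂ × ℂ} (ha : solitonTau p c ξ₀ a ≠ 0) :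
    partialFstLog (solitonTau p c ξ₀) a = solitonBracket p c ξ₀ 0 1 a := by
  rw [partialFstLog, partialFst, (hasDerivAt_solitonTau_fst hp hc ha).deriv,
    mul_div_cancel_right₀ _ ha]

theorem solitonX_eq {a : ℂ × ℂ} (ha : solitonTau p c ξ₀ a ≠ 0) :
    solitonX p c ξ₀ a = a.2 - 2 * solitonBracket p c ξ₀ 0 1 a := by
  rw [solitonX, partialFstLog_solitonF ha, partialFstLog_solitonTau hp hc ha]

theorem hasDerivAt_solitonBracket_zero_one_fst {a : ℂ × ℂ} (ha : solitonTau p c ξ₀ a ≠ 0) :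
    HasDerivAt (fun s => solitonBracket p c ξ₀ 0 1 (s, a.2))
      (solitonBracket p c ξ₀ 0 2 a - solitonBracket p c ξ₀ 0 1 a ^ 2) a.1 := by
  have hdet := isUnit_det_solitonMatrix hc ha
  refine (hasDerivAt_solitonBracket_fst hp hdet 0 1).congr_deriv ?_
  norm_num [solitonBracket_self hc hdet]
  ring

theorem solitonU_eq {a : ℂ × ℂ} (ha : solitonTau p c ξ₀ a ≠ 0) :
    solitonU p c ξ₀ a = -2 * (solitonBracket p c ξ₀ 0 2 a - solitonBracket p c ξ₀ 0 1 a ^ 2) := by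
  have h : (fun s => partialFstLog (solitonTau p c ξ₀) (s, a.2)) =ᶠ[nhds a.1]
      fun s => solitonBracket p c ξ₀ 0 1 (s, a.2) := by
    filter_upwards [eventually_solitonTau_ne_zero_fst ha] with s hs
      using partialFstLog_solitonTau hp hc hs
  rw [solitonU_eq_partialFst ha, partialFst, h.deriv_eq,
    (hasDerivAt_solitonBracket_zero_one_fst hp hc ha).deriv]

/-- This identity makes `∂_{x₁}` become `∂_t + u∂_x` in the new variables, and it is integrated for
the formula from `-∞`. -/
theorem hasDerivAt_solitonX_fst {a : ℂ × ℂ} (ha : solitonTau p c ξ₀ a ≠ 0) :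
    HasDerivAt (fun s => solitonX p c ξ₀ (s, a.2)) (solitonU p c ξ₀ a) a.1 := by
  have h := ((hasDerivAt_solitonBracket_zero_one_fst hp hc ha).const_mul 2).const_sub a.2
  rw [solitonU_eq hp hc ha, neg_mul]
  refine h.congr_of_eventuallyEq ?_
  filter_upwards [eventually_solitonTau_ne_zero_fst ha] with s hs using solitonX_eq hp hc hs

theorem hasDerivAt_solitonX_snd {a : ℂ × ℂ} (ha : solitonTau p c ξ₀ a ≠ 0) :
    HasDerivAt (fun s => solitonX p c ξ₀ (a.1, s))
      (1 - 2 * (solitonBracket p c ξ₀ (-1) 1 a +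
        solitonBracket p c ξ₀ 0 (-1) a * solitonBracket p c ξ₀ 0 1 a)) a.2 := by
  have hdet := isUnit_det_solitonMatrix hc ha
  have h := (hasDerivAt_id a.2).sub ((hasDerivAt_solitonBracket_snd hp hdet 0 1).const_mul 2)
  refine (h.congr_of_eventuallyEq ?_).congr_deriv ?_
  · filter_upwards [eventually_solitonTau_ne_zero_snd ha] with s hs using solitonX_eq hp hc hs
  · norm_num [solitonBracket_self hc hdet]

theorem partialSnd_solitonX {a : ℂ × ℂ} (ha : solitonTau p c ξ₀ a ≠ 0) :
    partialSnd (solitonX p c ξ₀) a = 1 - 2 * (solitonBracket p c ξ₀ (-1) 1 a +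
      solitonBracket p c ξ₀ 0 (-1) a * solitonBracket p c ξ₀ 0 1 a) :=
  (hasDerivAt_solitonX_snd hp hc ha).deriv

theorem contDiffAt_solitonX {n : ℕ∞ω} {a : ℂ × ℂ} (ha : solitonTau p c ξ₀ a ≠ 0) :
    ContDiffAt ℂ n (solitonX p c ξ₀) a := by
  have h : ContDiffAt ℂ n (fun a : ℂ × ℂ => a.2 - 2 * solitonBracket p c ξ₀ 0 1 a) a :=
    contDiffAt_snd.sub (contDiffAt_const.mul
      (contDiffAt_solitonBracket p c ξ₀ (isUnit_det_solitonMatrix hc ha) 0 1))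
  refine h.congr_of_eventuallyEq ?_
  filter_upwards [isOpen_solitonTau_ne_zero.mem_nhds ha] with b hb using solitonX_eq hp hc hb

theorem contDiffAt_solitonU {n : ℕ∞ω} {a : ℂ × ℂ} (ha : solitonTau p c ξ₀ a ≠ 0) :
    ContDiffAt ℂ n (solitonU p c ξ₀) a := by
  have hdet := isUnit_det_solitonMatrix hc ha
  have h : ContDiffAt ℂ n (fun a : ℂ × ℂ =>
      -2 * (solitonBracket p c ξ₀ 0 2 a - solitonBracket p c ξ₀ 0 1 a ^ 2)) a :=
    contDiffAt_const.mul ((contDiffAt_solitonBracket p c ξ₀ hdet 0 2).sub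
      ((contDiffAt_solitonBracket p c ξ₀ hdet 0 1).pow 2))
  refine h.congr_of_eventuallyEq ?_
  filter_upwards [isOpen_solitonTau_ne_zero.mem_nhds ha] with b hb using solitonU_eq hp hc hb

theorem isOpen_solitonRegularSet : IsOpen (solitonRegularSet p c ξ₀) := by
  rw [isOpen_iff_mem_nhds]
  rintro a ⟨ha, hρ⟩
  have hdet := isUnit_det_solitonMatrix hc ha
  have hcont : ContinuousAt (fun b => 1 - 2 * (solitonBracket p c ξ₀ (-1) 1 b +
      solitonBracket p c ξ₀ 0 (-1) b * solitonBracket p c ξ₀ 0 1 b)) a := by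
    have h := fun k l => (contDiffAt_solitonBracket (n := 0) p c ξ₀ hdet k l).continuousAt
    exact continuousAt_const.sub (continuousAt_const.mul
      ((h _ _).add ((h _ _).mul (h _ _))))
  rw [partialSnd_solitonX hp hc ha] at hρ
  filter_upwards [isOpen_solitonTau_ne_zero.mem_nhds ha, hcont.eventually_ne hρ] with b hb hb'
  exact ⟨hb, by rwa [partialSnd_solitonX hp hc hb]⟩

variable (hred : ∀ i, p i ^ 2 - p i * p i.rev + p i.rev ^ 2 = 0)
include hred

/-- The only place where the reduction is applied: differentiating `⟨0,2⟩` gives `⟨1,2⟩ + ⟨0,3⟩ =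
3⟨1,2⟩`, up to products. -/
theorem hasDerivAt_solitonU_fst {a : ℂ × ℂ} (ha : solitonTau p c ξ₀ a ≠ 0) :
    HasDerivAt (fun s => solitonU p c ξ₀ (s, a.2))
      (-2 * (3 * solitonBracket p c ξ₀ 1 2 a -
        3 * solitonBracket p c ξ₀ 0 1 a * solitonBracket p c ξ₀ 0 2 a +
        2 * solitonBracket p c ξ₀ 0 1 a ^ 3)) a.1 := by
  have hdet := isUnit_det_solitonMatrix hc ha
  have h := ((hasDerivAt_solitonBracket_fst hp hdet 0 2).sub
    ((hasDerivAt_solitonBracket_zero_one_fst hp hc ha).fun_pow 2)).const_mul (-2)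
  refine (h.congr_of_eventuallyEq ?_).congr_deriv ?_
  · filter_upwards [eventually_solitonTau_ne_zero_fst ha] with s hs using solitonU_eq hp hc hs
  · norm_num [solitonBracket_self hc hdet, solitonBracket_zero_three hp hred hc hdet]
    ring

/-- The reduced Ostrovsky equation before the change of variables. Once `⟨0,3⟩` is gone, it is a
polynomial identity in brackets with indices from -1 to 2, using only skew-symmetry. -/
theorem hasDerivAt_partialFst_solitonU_snd {a : ℂ × ℂ} (ha : solitonTau p c ξ₀ a ≠ 0) :
    HasDerivAt (fun s => partialFst (solitonU p c ξ₀) (a.1, s))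
      (3 * partialSnd (solitonX p c ξ₀) a * solitonU p c ξ₀ a) a.2 := by
  have hdet := isUnit_det_solitonMatrix hc ha
  have h := fun k l => hasDerivAt_solitonBracket_snd hp hdet k l
  have h := ((((h 1 2).const_mul 3).sub (((h 0 1).const_mul 3).mul (h 0 2))).add
    (((h 0 1).fun_pow 3).const_mul 2)).const_mul (-2)
  refine (h.congr_of_eventuallyEq ?_).congr_deriv ?_
  · filter_upwards [eventually_solitonTau_ne_zero_snd ha] with s hs
      using (hasDerivAt_solitonU_fst hp hc hred hs).deriv
  · rw [partialSnd_solitonX hp hc ha, solitonU_eq hp hc ha]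
    norm_num [solitonBracket_self hc hdet]
    rw [solitonBracket_skew hc hdet 1 0, solitonBracket_skew hc hdet 1 (-1)]
    ring

end

end SolitonEquation

/-! ### The hodograph transformation and its chain rule. -/

section Hodograph

section

variable {𝕜 : Type*} [NontriviallyNormedField 𝕜] {F : 𝕜 × 𝕜 → 𝕜} {a : 𝕜 × 𝕜}

theorem DifferentiableAt.partialFst_eq (hF : DifferentiableAt 𝕜 F a) :
    partialFst F a = fderiv 𝕜 F a (1, 0) :=
  (hF.hasFDerivAt.comp_hasDerivAt (f := fun s => (s, a.2)) a.1
    ((hasDerivAt_id a.1).prodMk (hasDerivAt_const a.1 a.2))).deriv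

theorem DifferentiableAt.partialSnd_eq (hF : DifferentiableAt 𝕜 F a) :
    partialSnd F a = fderiv 𝕜 F a (0, 1) :=
  (hF.hasFDerivAt.comp_hasDerivAt (f := fun s => (a.1, s)) a.2
    ((hasDerivAt_const a.2 a.1).prodMk (hasDerivAt_id a.2))).deriv

theorem DifferentiableAt.fderiv_eq_partial (hF : DifferentiableAt 𝕜 F a) (x y : 𝕜) :
    fderiv 𝕜 F a (x, y) = x * partialFst F a + y * partialSnd F a := by
  have h : ((x, y) : 𝕜 × 𝕜) = x • (1, 0) + y • (0, 1) := by simp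
  rw [h, map_add, map_smul, map_smul, hF.partialFst_eq, hF.partialSnd_eq, smul_eq_mul, smul_eq_mul]

theorem ContDiffAt.partialFst (hF : ContDiffAt 𝕜 ∞ F a) :
    ContDiffAt 𝕜 ∞ (_root_.partialFst F) a := by
  refine (((hF.fderiv_right (m := ∞) (by simp)).clm_apply
    (contDiffAt_const (c := ((1, 0) : 𝕜 × 𝕜))))).congr_of_eventuallyEq ?_
  filter_upwards [(hF.of_le (m := 1) (by simp)).eventually (by simp)] with b hb
  exact (hb.differentiableAt one_ne_zero).partialFst_eq

theorem ContDiffAt.partialSnd (hF : ContDiffAt 𝕜 ∞ F a) :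
    ContDiffAt 𝕜 ∞ (_root_.partialSnd F) a := by
  refine (((hF.fderiv_right (m := ∞) (by simp)).clm_apply
    (contDiffAt_const (c := ((0, 1) : 𝕜 × 𝕜))))).congr_of_eventuallyEq ?_
  filter_upwards [(hF.of_le (m := 1) (by simp)).eventually (by simp)] with b hb
  exact (hb.differentiableAt one_ne_zero).partialSnd_eq

/-- The derivative `(x, y) ↦ (α x + β y, x)` of a hodograph transformation. -/
noncomputable def hodographDeriv (α β : 𝕜) (hβ : β ≠ 0) : (𝕜 × 𝕜) ≃L[𝕜] (𝕜 × 𝕜) :=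
  ContinuousLinearEquiv.equivOfInverse
    ((α • ContinuousLinearMap.fst 𝕜 𝕜 𝕜 + β • ContinuousLinearMap.snd 𝕜 𝕜 𝕜).prod
      (ContinuousLinearMap.fst 𝕜 𝕜 𝕜))
    ((ContinuousLinearMap.snd 𝕜 𝕜 𝕜).prod
      (β⁻¹ • (ContinuousLinearMap.fst 𝕜 𝕜 𝕜 - α • ContinuousLinearMap.snd 𝕜 𝕜 𝕜)))
    (fun z => by ext <;> simp [hβ]) (fun z => by ext <;> simp [hβ])

theorem hasFDerivAt_hodograph (hF : DifferentiableAt 𝕜 F a) (h : partialSnd F a ≠ 0) :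
    HasFDerivAt (fun b => (F b, b.1))
      (hodographDeriv (partialFst F a) (partialSnd F a) h : (𝕜 × 𝕜) →L[𝕜] (𝕜 × 𝕜)) a := by
  refine (hF.hasFDerivAt.prodMk hasFDerivAt_fst).congr_fderiv ?_
  refine ContinuousLinearMap.ext fun z => ?_
  refine Prod.ext ?_ rfl
  have := hF.fderiv_eq_partial z.1 z.2
  rw [Prod.mk.eta] at this
  change fderiv 𝕜 F a z = partialFst F a * z.1 + partialSnd F a * z.2
  rw [this]
  ring

/-- The chain rule for a hodograph transformation. -/
theorem partial_comp_hodograph {X G g : 𝕜 × 𝕜 → 𝕜} (hX : DifferentiableAt 𝕜 X a)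
    (hG : DifferentiableAt 𝕜 G (X a, a.1)) (hg : ∀ᶠ b in nhds a, G (X b, b.1) = g b) :
    partialFst g a = partialSnd G (X a, a.1) + partialFst X a * partialFst G (X a, a.1) ∧
      partialSnd g a = partialSnd X a * partialFst G (X a, a.1) := by
  have hcomp : HasFDerivAt (fun b => G (X b, b.1))
      ((fderiv 𝕜 G (X a, a.1)).comp ((fderiv 𝕜 X a).prod (ContinuousLinearMap.fst 𝕜 𝕜 𝕜))) a :=
    hG.hasFDerivAt.comp (f := fun b : 𝕜 × 𝕜 => (X b, b.1)) a
      (hX.hasFDerivAt.prodMk hasFDerivAt_fst)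
  have hg' : HasFDerivAt g _ a := hcomp.congr_of_eventuallyEq (hg.mono fun b hb => hb.symm)
  have hd := hg'.differentiableAt
  rw [hd.partialFst_eq, hd.partialSnd_eq, hg'.fderiv, hX.partialFst_eq, hX.partialSnd_eq]
  constructor
  · simp [hG.fderiv_eq_partial]
    ring
  · simp [hG.fderiv_eq_partial]

end

variable {𝕜 : Type*} [RCLike 𝕜] {X u : 𝕜 × 𝕜 → 𝕜} {D : Set (𝕜 × 𝕜)}

/-- A smooth map with invertible derivatives that is injective on an open set has an open image
and a smooth inverse. -/
theorem contDiffAt_invFunOn {E : Type*} [NormedAddCommGroup E] [NormedSpace 𝕜 E]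
    [CompleteSpace E] [Nonempty E] {f : E → E} {W : Set E} (hW : IsOpen W) (hinj : Set.InjOn f W)
    {f' : E ≃L[𝕜] E} {a : E} (ha : a ∈ W) (hf : ContDiffAt 𝕜 ∞ f a)
    (hf' : HasFDerivAt f (f' : E →L[𝕜] E) a) :
    f '' W ∈ nhds (f a) ∧ ContDiffAt 𝕜 ∞ (Function.invFunOn f W) (f a) := by
  have hn : (∞ : ℕ∞ω) ≠ 0 := by simp
  set e := hf.toOpenPartialHomeomorph f hf' hn with he
  have hecoe : (e : E → E) = f := hf.toOpenPartialHomeomorph_coe hf' hn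
  have htarget : f a ∈ e.target := hf.image_mem_toOpenPartialHomeomorph_target hf' hn
  have hsource : a ∈ e.source := hf.mem_toOpenPartialHomeomorph_source hf' hn
  have hea : e.symm (f a) = a := by rw [← hecoe]; exact e.left_inv hsource
  -- Near `f a` the local inverse takes values in `W`, so injectivity on `W` identifies it with the
  -- global inverse.
  have hev : ∀ᶠ q in nhds (f a), q ∈ e.target ∧ e.symm q ∈ W := by
    refine Filter.Eventually.and (e.open_target.mem_nhds htarget)
      ((e.symm.continuousAt htarget).eventually ?_)
    rw [hea]
    exact hW.mem_nhds ha
  have hfe : ∀ q ∈ e.target, f (e.symm q) = q := fun q hq => by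
    rw [← hecoe]; exact e.right_inv hq
  refine ⟨?_, (hf.to_localInverse hf' hn).congr_of_eventuallyEq ?_⟩
  · filter_upwards [hev] with q hq using ⟨_, hq.2, hfe q hq.1⟩
  · filter_upwards [hev] with q hq
    have hmem : ∃ b ∈ W, f b = q := ⟨_, hq.2, hfe q hq.1⟩
    exact hinj (Function.invFunOn_mem hmem) hq.2
      ((Function.invFunOn_eq hmem).trans (hfe q hq.1).symm)

/-- The inverse function theorem gives the geometry. For the equation, the chain rule is used twice:
`u_{x₁}` corresponds to `v_t + v v_x`, and its `x₋₁`-derivative is `X_{x₋₁}` times the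
`x`-derivative of that. -/
theorem isParametricSolutionOn_of_partial (hD : IsOpen D) (hX : ∀ a ∈ D, ContDiffAt 𝕜 ∞ X a)
    (hu : ∀ a ∈ D, ContDiffAt 𝕜 ∞ u a) (hXfst : ∀ a ∈ D, partialFst X a = u a)
    (hXsnd : ∀ a ∈ D, partialSnd X a ≠ 0)
    (heq : ∀ a ∈ D, partialSnd (partialFst u) a = 3 * partialSnd X a * u a) :
    IsParametricSolutionOn X u D := by
  have h0 : (∞ : ℕ∞ω) ≠ 0 := by simp
  have hΦ : ∀ a ∈ D, ContDiffAt 𝕜 ∞ (fun b => (X b, b.1)) a := fun a ha =>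
    (hX a ha).prodMk contDiffAt_fst
  have hΦ' := fun a ha => hasFDerivAt_hodograph ((hX a ha).differentiableAt h0) (hXsnd a ha)
  refine ⟨hD, fun a ha => ?_, fun W hWD hW hinj => ?_⟩
  · set e := (hΦ a ha).toOpenPartialHomeomorph _ (hΦ' a ha) h0 with he
    refine ⟨e.source ∩ D, Set.inter_subset_right, e.open_source.inter hD,
      ⟨(hΦ a ha).mem_toOpenPartialHomeomorph_source (hΦ' a ha) h0, ha⟩, ?_⟩
    have := e.injOn.mono (s₁ := e.source ∩ D) Set.inter_subset_left
    rwa [he, (hΦ a ha).toOpenPartialHomeomorph_coe (hΦ' a ha) h0] at this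
  · set Φ : 𝕜 × 𝕜 → 𝕜 × 𝕜 := fun b => (X b, b.1) with hΦdef
    have hinv := fun a (ha : a ∈ W) =>
      contDiffAt_invFunOn hW hinj ha (hΦ a (hWD ha)) (hΦ' a (hWD ha))
    have hleft : ∀ b ∈ W, Function.invFunOn Φ W (Φ b) = b := fun b hb =>
      hinj.leftInvOn_invFunOn hb
    set v : 𝕜 × 𝕜 → 𝕜 := fun q => u (Function.invFunOn Φ W q) with hv
    have hvΦ : ∀ b ∈ W, v (Φ b) = u b := fun b hb => by rw [hv]; exact congrArg u (hleft b hb)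
    have hvs : ∀ b ∈ W, ContDiffAt 𝕜 ∞ v (Φ b) := fun b hb => by
      refine ContDiffAt.comp (Φ b) ?_ (hinv b hb).2
      rw [hleft b hb]
      exact hu b (hWD hb)
    refine ⟨v, hvΦ, isOpen_iff_mem_nhds.2 ?_, ?_, ?_⟩
    · rintro _ ⟨b, hb, rfl⟩
      exact (hinv b hb).1
    · rintro _ ⟨b, hb, rfl⟩
      exact (hvs b hb).contDiffWithinAt
    · rintro _ ⟨b, hb, rfl⟩
      have hXd := fun b hb => (hX b (hWD hb)).differentiableAt h0
      have hus : ∀ b ∈ W, partialSnd v (Φ b) + v (Φ b) * partialFst v (Φ b) = partialFst u b := by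
        intro b hb
        rw [(partial_comp_hodograph (hXd b hb) ((hvs b hb).differentiableAt h0)
          (Filter.mem_of_superset (hW.mem_nhds hb) hvΦ)).1, hvΦ b hb, hXfst b (hWD hb)]
      have hG : ContDiffAt 𝕜 ∞ (fun r => partialSnd v r + v r * partialFst v r) (Φ b) :=
        (hvs b hb).partialSnd.add ((hvs b hb).mul (hvs b hb).partialFst)
      have h := (partial_comp_hodograph (hXd b hb) (hG.differentiableAt h0)
        (Filter.mem_of_superset (hW.mem_nhds hb) hus)).2
      rw [heq b (hWD hb), mul_right_comm, mul_comm (3 * u b)] at h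
      -- Cancel the non-zero Jacobian `X_{x₋₁}`.
      rw [← mul_left_cancel₀ (hXsnd b (hWD hb)) h, hvΦ b hb, sub_self]

end Hodograph

/-! ### Restriction to real points. -/

section RealPoints

theorem contDiff_complexPoint {n : ℕ∞ω} : ContDiff ℝ n complexPoint :=
  (Complex.ofRealCLM.contDiff.comp contDiff_fst).prodMk
    (Complex.ofRealCLM.contDiff.comp contDiff_snd)

/-- Real and imaginary part of the derivative of the restriction of a complex function to the
real line. -/
theorem HasDerivAt.re_im_of_complex {e : ℂ → ℂ} {e' : ℂ} {z : ℝ} (h : HasDerivAt e e' z) :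
    HasDerivAt (fun x : ℝ => (e x).re) e'.re z ∧ HasDerivAt (fun x : ℝ => (e x).im) e'.im z :=
  ⟨Complex.reCLM.hasFDerivAt.comp_hasDerivAt z h.comp_ofReal,
    Complex.imCLM.hasFDerivAt.comp_hasDerivAt z h.comp_ofReal⟩

theorem eventually_fst {D : Set (ℝ × ℝ)} (hD : IsOpen D) {a : ℝ × ℝ} (ha : a ∈ D) :
    ∀ᶠ s in nhds a.1, (s, a.2) ∈ D :=
  (Continuous.prodMk_left a.2).continuousAt.eventually (hD.mem_nhds ha)

theorem eventually_snd {D : Set (ℝ × ℝ)} (hD : IsOpen D) {a : ℝ × ℝ} (ha : a ∈ D) :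
    ∀ᶠ s in nhds a.2, (a.1, s) ∈ D :=
  (Continuous.prodMk_right a.1).continuousAt.eventually (hD.mem_nhds ha)

theorem HasDerivAt.eq_zero_of_eventually {f : ℝ → ℝ} {f' x : ℝ} (h : HasDerivAt f f' x)
    (hf : ∀ᶠ y in nhds x, f y = 0) : f' = 0 :=
  h.unique ((hasDerivAt_const x 0).congr_of_eventuallyEq hf)

theorem ContDiffAt.re_complexPoint {F : ℂ × ℂ → ℂ} {n : ℕ∞ω} {a : ℝ × ℝ}
    (hF : ContDiffAt ℂ n F (complexPoint a)) :
    ContDiffAt ℝ n (fun b => (F (complexPoint b)).re) a :=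
  Complex.reCLM.contDiff.contDiffAt.comp a
    ((hF.restrict_scalars ℝ).comp a contDiff_complexPoint.contDiffAt)

/-- A parametric solution in complex variables restricts to one in real variables. -/
theorem isParametricSolutionOn_re {X u : ℂ × ℂ → ℂ} {U : Set (ℂ × ℂ)}
    (hX : ∀ a ∈ U, ContDiffAt ℂ ∞ X a) (hu : ∀ a ∈ U, ContDiffAt ℂ ∞ u a)
    (hXfst : ∀ a ∈ U, partialFst X a = u a) (hXsnd : ∀ a ∈ U, partialSnd X a ≠ 0)
    (heq : ∀ a ∈ U, partialSnd (partialFst u) a = 3 * partialSnd X a * u a)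
    {D : Set (ℝ × ℝ)} (hD : IsOpen D) (hDU : ∀ a ∈ D, complexPoint a ∈ U)
    (hreal : ∀ a ∈ D, (X (complexPoint a)).im = 0) :
    (∀ a ∈ D, (u (complexPoint a)).im = 0) ∧
      IsParametricSolutionOn (fun a => (X (complexPoint a)).re)
        (fun a => (u (complexPoint a)).re) D := by
  have h0 : (∞ : ℕ∞ω) ≠ 0 := by simp
  have hfst : ∀ {F : ℂ × ℂ → ℂ} {a : ℝ × ℝ}, DifferentiableAt ℂ F (complexPoint a) →
      HasDerivAt (fun s : ℝ => (F (complexPoint (s, a.2))).re)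
        (partialFst F (complexPoint a)).re a.1 ∧
      HasDerivAt (fun s : ℝ => (F (complexPoint (s, a.2))).im)
        (partialFst F (complexPoint a)).im a.1 := by
    intro F a hF
    refine HasDerivAt.re_im_of_complex (e := fun s : ℂ => F (s, (a.2 : ℂ)))
      (DifferentiableAt.hasDerivAt ?_)
    exact hF.comp (f := fun s : ℂ => (s, (a.2 : ℂ))) (a.1 : ℂ) (by fun_prop)
  have hsnd : ∀ {F : ℂ × ℂ → ℂ} {a : ℝ × ℝ}, DifferentiableAt ℂ F (complexPoint a) →
      HasDerivAt (fun s : ℝ => (F (complexPoint (a.1, s))).re)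
        (partialSnd F (complexPoint a)).re a.2 ∧
      HasDerivAt (fun s : ℝ => (F (complexPoint (a.1, s))).im)
        (partialSnd F (complexPoint a)).im a.2 := by
    intro F a hF
    refine HasDerivAt.re_im_of_complex (e := fun s : ℂ => F ((a.1 : ℂ), s))
      (DifferentiableAt.hasDerivAt ?_)
    exact hF.comp (f := fun s : ℂ => ((a.1 : ℂ), s)) (a.2 : ℂ) (by fun_prop)
  have hXd := fun a (ha : a ∈ D) => (hX _ (hDU a ha)).differentiableAt h0
  have hud := fun a (ha : a ∈ D) => (hu _ (hDU a ha)).differentiableAt h0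
  -- `u` is the derivative of `X` along a real line on which `X` is real near the point; the same
  -- argument makes the Jacobian real.
  have huim : ∀ a ∈ D, (u (complexPoint a)).im = 0 := fun a ha => by
    rw [← hXfst _ (hDU a ha)]
    exact (hfst (hXd a ha)).2.eq_zero_of_eventually ((eventually_fst hD ha).mono fun s hs =>
      hreal _ hs)
  have hρim : ∀ a ∈ D, (partialSnd X (complexPoint a)).im = 0 := fun a ha =>
    (hsnd (hXd a ha)).2.eq_zero_of_eventually ((eventually_snd hD ha).mono fun s hs => hreal _ hs)
  have hρ : ∀ a ∈ D, partialSnd (fun a => (X (complexPoint a)).re) a =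
      (partialSnd X (complexPoint a)).re := fun a ha => (hsnd (hXd a ha)).1.deriv
  have hus : ∀ a ∈ D, partialFst (fun a => (u (complexPoint a)).re) a =
      (partialFst u (complexPoint a)).re := fun a ha => (hfst (hud a ha)).1.deriv
  refine ⟨huim, isParametricSolutionOn_of_partial hD (fun a ha => (hX _ (hDU a ha)).re_complexPoint)
    (fun a ha => (hu _ (hDU a ha)).re_complexPoint) (fun a ha => ?_) (fun a ha => ?_)
    (fun a ha => ?_)⟩
  · rw [← hXfst _ (hDU a ha)]
    exact (hfst (hXd a ha)).1.deriv
  -- The complex Jacobian is real and non-zero, so its real part cannot vanish.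
  · rw [hρ a ha]
    exact fun h => hXsnd _ (hDU a ha) (Complex.ext h (hρim a ha))
  · have h1 : (fun s => partialFst (fun a => (u (complexPoint a)).re) (a.1, s)) =ᶠ[nhds a.2]
        fun s => (partialFst u (complexPoint (a.1, s))).re :=
      (eventually_snd hD ha).mono fun s hs => hus _ hs
    have h2 := (hsnd (a := a) ((hu _ (hDU a ha)).partialFst.differentiableAt h0)).1
    rw [hρ a ha, partialSnd, h1.deriv_eq, h2.deriv, heq _ (hDU a ha)]
    simp [Complex.mul_re, huim a ha, hρim a ha]

end RealPoints

/-! ### Decay as `x₁ → -∞` and the integral formula. -/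

section Asymptotics

open Matrix Filter Topology Asymptotics

variable {N : ℕ} {p c ξ₀ : Fin (2 * N) → ℂ}

/-- The mean `(ξ_i + ξ_{2N+1-i}) / 2` of two conjugate phases. -/
noncomputable def meanPhase (p ξ₀ : Fin (2 * N) → ℂ) (i : Fin (2 * N)) (a : ℂ × ℂ) : ℂ :=
  (phase p ξ₀ i a + phase p ξ₀ i.rev a) / 2

/-- The matrix of the tau function with each phase replaced by the mean phase. -/
noncomputable def meanMatrix (p c ξ₀ : Fin (2 * N) → ℂ) (a : ℂ × ℂ) :
    Matrix (Fin (2 * N)) (Fin (2 * N)) ℂ :=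
  Matrix.of fun i j => (if j = i.rev then c i else 0) +
    (p i - p j) / (p i + p j) * Complex.exp (meanPhase p ξ₀ i a + meanPhase p ξ₀ j a)

/-- The constant part of the matrix of the tau function. -/
noncomputable def antidiagonal (c : Fin (2 * N) → ℂ) : Matrix (Fin (2 * N)) (Fin (2 * N)) ℂ :=
  Matrix.of fun i j => if j = i.rev then c i else 0

theorem isUnit_det_antidiagonal (hc : ∀ i, c i ≠ 0) : IsUnit (antidiagonal c).det := by
  refine isUnit_det_of_right_inverse
    (B := Matrix.of fun i j => if i = j.rev then (c j)⁻¹ else 0) ?_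
  ext i j
  simp only [antidiagonal, mul_apply, of_apply, ite_mul, zero_mul, Finset.sum_ite_eq',
    Finset.mem_univ, if_true, Fin.rev_inj, one_apply]
  split_ifs with h
  · rw [h, mul_inv_cancel₀ (hc j)]
  · rw [mul_zero]

/-- The gauge transformation that replaces each phase by the mean phase. -/
theorem solitonBracket_eq_meanMatrix (k l : ℤ) (a : ℂ × ℂ) :
    solitonBracket p c ξ₀ k l a = ∑ i, p i ^ k * Complex.exp (meanPhase p ξ₀ i a) *
      ∑ j, (meanMatrix p c ξ₀ a)⁻¹ i j * (p j ^ l * Complex.exp (meanPhase p ξ₀ j a)) := by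
  -- Because `d_i d_{2N+1-i} = 1`, conjugating by `diagonal d` keeps the constants `c_{i,j}` while
  -- averaging the phases. The decay rates become `Re(p_i + p_{2N+1-i})/2`, positive even if some
  -- `Re p_i` is not.
  set d : Fin (2 * N) → ℂ := fun i =>
    Complex.exp ((phase p ξ₀ i.rev a - phase p ξ₀ i a) / 2) with hd
  have hd0 : ∀ i, d i ≠ 0 := fun i => Complex.exp_ne_zero _
  have hde : ∀ i, d i * Complex.exp (phase p ξ₀ i a) = Complex.exp (meanPhase p ξ₀ i a) := by
    intro i
    rw [hd, ← Complex.exp_add, meanPhase]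
    ring_nf
  have hM : meanMatrix p c ξ₀ a = diagonal d * solitonMatrix p c ξ₀ a * diagonal d := by
    ext i j
    have hcd : d i * (if j = i.rev then c i else 0) * d j = if j = i.rev then c i else 0 := by
      split_ifs with h
      · subst h
        have : d i * d i.rev = 1 := by
          rw [hd, ← Complex.exp_add, Fin.rev_rev]
          ring_nf
          simp
        linear_combination c i * this
      · ring
    simp only [mul_diagonal, diagonal_mul, meanMatrix, solitonMatrix, of_apply, Complex.exp_add,
      ← hde]
    linear_combination -hcd
  have hunit : IsUnit (diagonal d).det := by
    rw [det_diagonal, isUnit_iff_ne_zero]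
    exact Finset.prod_ne_zero_iff.2 fun i _ => hd0 i
  have hinv : (solitonMatrix p c ξ₀ a)⁻¹ =
      diagonal d * (meanMatrix p c ξ₀ a)⁻¹ * diagonal d := by
    rw [hM, Matrix.mul_inv_rev, Matrix.mul_inv_rev, ← Matrix.mul_assoc, ← Matrix.mul_assoc,
      mul_nonsing_inv _ hunit, Matrix.one_mul, Matrix.mul_assoc, nonsing_inv_mul _ hunit,
      Matrix.mul_one]
  simp only [solitonBracket, dotProduct, mulVec, hinv, mul_diagonal, diagonal_mul, solitonVec,
    ← hde, Finset.mul_sum]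
  refine Finset.sum_congr rfl fun i _ => Finset.sum_congr rfl fun j _ => ?_
  ring

theorem isBigO_exp_meanPhase {m : ℝ} {i : Fin (2 * N)} (hm : m ≤ ((p i + p i.rev) / 2).re)
    (y : ℝ) : (fun s : ℝ => Complex.exp (meanPhase p ξ₀ i (complexPoint (s, y)))) =O[atBot]
      fun s => Real.exp (m * s) := by
  set b : ℂ := meanPhase p ξ₀ i (0, (y : ℂ)) with hb
  have heq : ∀ s : ℝ, meanPhase p ξ₀ i (complexPoint (s, y)) = (p i + p i.rev) / 2 * s + b := by
    intro s
    simp only [hb, meanPhase, phase, complexPoint]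
    ring
  refine IsBigO.of_bound (Real.exp b.re) ?_
  -- For `s ≤ 0` lowering the rate to `m` can only enlarge the bound.
  filter_upwards [eventually_le_atBot 0] with s hs
  rw [heq, Complex.norm_exp, Real.norm_eq_abs, Real.abs_exp, ← Real.exp_add, Real.exp_le_exp,
    Complex.add_re, Complex.re_mul_ofReal]
  nlinarith

theorem exists_pos_le_of_finite {ι : Type*} [Finite ι] {f : ι → ℝ} (hf : ∀ i, 0 < f i) :
    ∃ m > 0, ∀ i, m ≤ f i := by
  cases isEmpty_or_nonempty ι
  -- This covers `N = 0`, where any positive rate serves.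
  · exact ⟨1, one_pos, fun i => isEmptyElim i⟩
  · obtain ⟨i, hi⟩ := Finite.exists_min f
    exact ⟨f i, hf i, hi⟩

theorem tendsto_exp_mul_atBot {m : ℝ} (hm : 0 < m) :
    Tendsto (fun s : ℝ => Real.exp (m * s)) atBot (𝓝 0) :=
  Real.tendsto_exp_atBot.comp (tendsto_id.const_mul_atBot hm)

/-- In the averaged gauge the matrix tends to the invertible `antidiagonal c`, so its inverse stays
bounded. One exponential supplies the rate; the other is merely bounded. -/
theorem isBigO_solitonBracket (hc0 : ∀ i, c i ≠ 0) {m : ℝ} (hm0 : 0 < m)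
    (hm : ∀ i, m ≤ ((p i + p i.rev) / 2).re) (y : ℝ) (k l : ℤ) :
    (fun s : ℝ => solitonBracket p c ξ₀ k l (complexPoint (s, y))) =O[atBot]
      fun s => Real.exp (m * s) := by
  have hexp := fun i => isBigO_exp_meanPhase (ξ₀ := ξ₀) (hm i) y
  have hexp0 := fun i => (hexp i).trans_tendsto (tendsto_exp_mul_atBot hm0)
  have hM : Tendsto (fun s : ℝ => fun i j => meanMatrix p c ξ₀ (complexPoint (s, y)) i j) atBot
      (𝓝 fun i j => antidiagonal c i j) := by
    refine tendsto_pi_nhds.2 fun i => tendsto_pi_nhds.2 fun j => ?_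
    have := (((hexp0 i).mul (hexp0 j)).const_mul ((p i - p j) / (p i + p j))).const_add
      (if j = i.rev then c i else 0)
    simpa [meanMatrix, antidiagonal, Complex.exp_add] using this
  have hinv : ∀ i j, (fun s : ℝ => (meanMatrix p c ξ₀ (complexPoint (s, y)))⁻¹ i j) =O[atBot]
      fun _ => (1 : ℝ) := by
    intro i j
    have hcont : ContinuousAt (fun v : Fin (2 * N) → Fin (2 * N) → ℂ => (Matrix.of v)⁻¹ i j)
        (fun i j => antidiagonal c i j) :=
      (ContDiffAt.matrix_inv_apply (𝕜 := ℂ) (n := 0)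
        (A := fun v : Fin (2 * N) → Fin (2 * N) → ℂ => Matrix.of v)
        (fun i j => (contDiff_apply_apply ℂ ℂ i j).contDiffAt)
        (isUnit_det_antidiagonal hc0) i j).continuousAt
    exact Filter.Tendsto.isBigO_one ℝ (hcont.tendsto.comp hM)
  simp only [solitonBracket_eq_meanMatrix]
  refine IsBigO.fun_sum fun i _ => ?_
  have hinner : (fun s : ℝ => ∑ j, (meanMatrix p c ξ₀ (complexPoint (s, y)))⁻¹ i j *
      (p j ^ l * Complex.exp (meanPhase p ξ₀ j (complexPoint (s, y))))) =O[atBot]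
        fun _ => (1 : ℝ) := by
    refine IsBigO.fun_sum fun j _ => ?_
    simpa using (hinv i j).mul (((hexp0 j).isBigO_one ℝ).const_mul_left (p j ^ l))
  simpa using ((hexp i).const_mul_left (p i ^ k)).mul hinner

/-- Bracket decay makes `u` integrable and gives `x → x₋₁` at `-∞`, which fixes the constant when
`x_{x₁} = u` is integrated. -/
theorem integrableOn_solitonU_and_solitonX_eq (hp : ∀ i j, p i + p j ≠ 0)
    (hc : ∀ i, c i = -c i.rev) (hre : ∀ i, 0 < (p i + p i.rev).re) (hc0 : ∀ i, c i ≠ 0)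
    (x₁ y : ℝ) (hτ : ∀ s ≤ x₁, solitonTau p c ξ₀ (complexPoint (s, y)) ≠ 0) :
    MeasureTheory.IntegrableOn (fun s : ℝ => solitonU p c ξ₀ (complexPoint (s, y)))
      (Set.Iic x₁) ∧
    solitonX p c ξ₀ (complexPoint (x₁, y)) =
      (y : ℂ) + ∫ s in Set.Iic x₁, solitonU p c ξ₀ (complexPoint (s, y)) := by
  obtain ⟨m, hm0, hm⟩ := exists_pos_le_of_finite (f := fun i => ((p i + p i.rev) / 2).re)
    fun i => by simpa using hre i
  have hO := fun k l => isBigO_solitonBracket (ξ₀ := ξ₀) hc0 hm0 hm y k l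
  have h0 := fun k l => (hO k l).trans_tendsto (tendsto_exp_mul_atBot hm0)
  have hU : (fun s : ℝ => solitonU p c ξ₀ (complexPoint (s, y))) =O[atBot]
      fun s => Real.exp (m * s) := by
    have h1 : (fun s : ℝ => -2 * (solitonBracket p c ξ₀ 0 2 (complexPoint (s, y)) -
        solitonBracket p c ξ₀ 0 1 (complexPoint (s, y)) ^ 2)) =O[atBot]
          fun s => Real.exp (m * s) := by
      refine ((hO 0 2).sub ?_).const_mul_left (-2)
      simpa [sq] using (hO 0 1).mul ((h0 0 1).isBigO_one ℝ)
    refine h1.congr' ?_ EventuallyEq.rfl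
    filter_upwards [eventually_le_atBot x₁] with s hs using (solitonU_eq hp hc (hτ s hs)).symm
  have hint : MeasureTheory.IntegrableOn
      (fun s : ℝ => solitonU p c ξ₀ (complexPoint (s, y))) (Set.Iic x₁) := by
    refine MeasureTheory.LocallyIntegrableOn.integrableOn_of_isBigO_atBot
      (ContinuousOn.locallyIntegrableOn (fun s hs => ?_) measurableSet_Iic) hU
      ⟨Set.Iic 0, Iic_mem_atBot 0, integrableOn_exp_mul_Iic hm0 0⟩
    refine (ContinuousAt.comp (g := solitonU p c ξ₀) (f := fun s : ℝ => complexPoint (s, y))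
      (contDiffAt_solitonU (n := 0) hp hc (hτ s hs)).continuousAt ?_).continuousWithinAt
    exact ((contDiff_complexPoint (n := 0)).continuous.comp
      (Continuous.prodMk_left y)).continuousAt
  have hlim : Tendsto (fun s : ℝ => solitonX p c ξ₀ (complexPoint (s, y))) atBot (𝓝 (y : ℂ)) := by
    have h1 := ((h0 0 1).const_mul 2).const_sub (y : ℂ)
    rw [mul_zero, sub_zero] at h1
    refine h1.congr' ?_
    filter_upwards [eventually_le_atBot x₁] with s hs using (solitonX_eq hp hc (hτ s hs)).symm
  refine ⟨hint, ?_⟩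
  rw [MeasureTheory.integral_Iic_of_hasDerivAt_of_tendsto'
    (fun s hs => (hasDerivAt_solitonX_fst hp hc (hτ s hs)).comp_ofReal) hint hlim]
  exact (add_sub_cancel _ _).symm

end Asymptotics

theorem mainTheorem1 (N : ℕ) (p c ξ₀ : Fin (2 * N) → ℂ)
    (hp : ∀ i j, p i + p j ≠ 0)
    (hred : ∀ i, p i ^ 2 - p i * p i.rev + p i.rev ^ 2 = 0)
    (hc : ∀ i, c i = -c i.rev) :
    (∀ a, solitonTau p c ξ₀ a ≠ 0 →
      solitonU p c ξ₀ a = -2 * partialFst (partialFstLog (solitonTau p c ξ₀)) a) ∧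
    IsParametricSolutionOn (solitonX p c ξ₀) (solitonU p c ξ₀) (solitonRegularSet p c ξ₀) ∧
    (∀ D : Set (ℝ × ℝ), IsOpen D →
      (∀ a ∈ D, complexPoint a ∈ solitonRegularSet p c ξ₀) →
      (∀ a ∈ D, (solitonX p c ξ₀ (complexPoint a)).im = 0) →
      (∀ a ∈ D, (solitonU p c ξ₀ (complexPoint a)).im = 0) ∧
      IsParametricSolutionOn (fun a => (solitonX p c ξ₀ (complexPoint a)).re)
        (fun a => (solitonU p c ξ₀ (complexPoint a)).re) D) ∧
    ((∀ i, 0 < (p i + p i.rev).re) → (∀ i, c i ≠ 0) →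
      ∀ x₁ y : ℝ, (∀ s ≤ x₁, solitonTau p c ξ₀ (complexPoint (s, y)) ≠ 0) →
        MeasureTheory.IntegrableOn (fun s : ℝ => solitonU p c ξ₀ (complexPoint (s, y)))
          (Set.Iic x₁) ∧
        solitonX p c ξ₀ (complexPoint (x₁, y)) =
          (y : ℂ) + ∫ s in Set.Iic x₁, solitonU p c ξ₀ (complexPoint (s, y))) := by
  have hX := fun a (ha : a ∈ solitonRegularSet p c ξ₀) =>
    contDiffAt_solitonX (n := ∞) hp hc ha.1
  have hu := fun a (ha : a ∈ solitonRegularSet p c ξ₀) =>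
    contDiffAt_solitonU (n := ∞) hp hc ha.1
  have hXfst : ∀ a ∈ solitonRegularSet p c ξ₀,
      partialFst (solitonX p c ξ₀) a = solitonU p c ξ₀ a := fun a ha =>
    (hasDerivAt_solitonX_fst hp hc ha.1).deriv
  have hXsnd : ∀ a ∈ solitonRegularSet p c ξ₀, partialSnd (solitonX p c ξ₀) a ≠ 0 :=
    fun a ha => ha.2
  have heq : ∀ a ∈ solitonRegularSet p c ξ₀, partialSnd (partialFst (solitonU p c ξ₀)) a =
      3 * partialSnd (solitonX p c ξ₀) a * solitonU p c ξ₀ a := fun a ha =>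
    (hasDerivAt_partialFst_solitonU_snd hp hc hred ha.1).deriv
  exact ⟨fun a ha => solitonU_eq_partialFst ha,
    isParametricSolutionOn_of_partial (isOpen_solitonRegularSet hp hc) hX hu hXfst hXsnd heq,
    fun D hD hDU hreal => isParametricSolutionOn_re hX hu hXfst hXsnd heq hD hDU hreal,
    fun hre hc0 x₁ y hτ => integrableOn_solitonU_and_solitonX_eq hp hc hre hc0 x₁ y hτ⟩
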